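/- **Theorem (Gröbner fan).** Let $k$ be a field and let $R$ be an almost centralizing extension of $B=k[x_1,\dots,x_m]$: a $k$-algebra generated by commuting elements $x_1,\dots,x_m$ together with elements $y_1,\dots,y_n$, subject only to relations $$y_ix_j-x_jy_i=Q^1_{i,j}(x),\qquad y_iy_j-y_jy_i=Q^{2,0}_{i,j}(x)+\sum_{\ell=1}^nQ^{2,\ell}_{i,j}(x)\,y_\ell=:Q^2_{i,j}$$ with $Q^1_{i,j},Q^{2,\ell}_{i,j}\in B$, such that the standard monomials $x^{\mathbf a}y^{\mathbf b}$, $(\mathbf a,\mathbf b)\in\mathbb N^m\times\mathbb N^n$, form a $k$-basis of $R$. For $(\mathbf u,\mathbf v)\in\mathbb R^m\times\mathbb R^n$ the weight of $x^{\mathbf a}y^{\mathbf b}$ is $\mathbf u\cdot\mathbf a+\mathbf v\cdot\mathbf b$, and $\deg_{(\mathbf u,\mathbf v)}f$ is the maximal weight of a standard monomial occurring in $f$ (with $\deg 0=-\infty$). Let $S=k[\bar x_1,\dots,\bar x_m,\bar y_1,\dots,\bar y_n]$ be the commutative polynomial ring, and let $\operatorname{in}_{(\mathbf u,\mathbf v)}(f)\in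 S$ be the sum of the terms $\kappa_{\mathbf a,\mathbf b}\bar x^{\mathbf a}\bar y^{\mathbf b}$ of maximal weight in the standard expression $f=\sum\kappa_{\mathbf a,\mathbf b}x^{\mathbf a}y^{\mathbf b}$. The polynomial region $\operatorname{PR}(R)$ is the open convex polyhedral cone of all $(\mathbf u,\mathbf v)$ with $u_j+v_i>\deg_{(\mathbf u,\mathbf v)}Q^1_{i,j}$ and $v_i+v_j>\deg_{(\mathbf u,\mathbf v)}Q^2_{i,j}$ for all $i,j$. Let $I$ be a left ideal of $R$, and let $\operatorname{in}_{(\mathbf u,\mathbf v)}(I)$ be the $k$-span of $\{\operatorname{in}_{(\mathbf u,\mathbf v)}(f):f\in I\}$. Two vectors of $\operatorname{PR}(R)$ are equivalent if they give the same $\operatorname{in}_{(\mathbf u,\mathbf v)}(I)$; write $C_I[(\mathbf u,\mathbf v)]\subseteq\operatorname{PR}(R)$ for the equivalence class of $(\mathbf u,\mathbf v)$. The Gröbner region $\operatorname{GR}(I)$ is the set of vectors of $\operatorname{PR}(R)$ that are equivalent to some vector of $\operatorname{PR}(R)$ with all coordinates positive. Then the closures in $\mathbb R^m\times\mathbb R^n$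 of the equivalence classes, $$\operatorname{GF}(I)=\{\overline{C_I[(\mathbf u,\mathbf v)]}:(\mathbf u,\mathbf v)\in\operatorname{GR}(I)\},$$ form a finite fan in the Gröbner region, the Gröbner fan of $I$. Precisely: 1. $\operatorname{GF}(I)$ is a finite set of rational convex polyhedral cones. 2. $\operatorname{GF}(I)$ together with all faces of its members is a rational fan in $\mathbb R^m\times\mathbb R^n$: a nonempty finite collection of rational polyhedral cones, closed under passing to faces, in which any two cones meet in a common face of both. In particular any two members of $\operatorname{GF}(I)$ meet in a common face. 3. A face $F$ of a member of $\operatorname{GF}(I)$ belongs to $\operatorname{GF}(I)$ if and only if $F\cap\operatorname{GR}(I)\ne\emptyset$. -/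

import Mathlib

/-- The ordered monomial `z₁ ^ a₁ * ⋯ * z_p ^ a_p` in a (possibly noncommutative) ring. -/
def orderedMonomial {R : Type*} [Ring R] {p : ℕ} (z : Fin p → R) (a : Fin p → ℕ) : R :=
  (List.ofFn fun i => z i ^ a i).prod

/-- The element `q(x₁, …, x_m)` of `R`, for a commutative polynomial `q` and elements `x_i` of a
`k`-algebra `R`. -/
noncomputable def evalOrdered {k R : Type*} [Field k] [Ring R] [Algebra k R] {m : ℕ}
    (x : Fin m → R) (q : MvPolynomial (Fin m) k) : R :=
  ∑ a ∈ q.support, q.coeff a • orderedMonomial x a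

/-- The structure on a `k`-algebra `R` of an almost centralizing extension of the commutative
polynomial ring `B = k[x₁, …, x_m]`: generators `x_i`, `y_j`, the two families of relations, and
the fact that the standard monomials `x^a y^b` form a `k`-basis (so `R` is generated by the `x_i`
and `y_j` subject only to these relations and the commutation of the `x_i`).
The index `Sum.inl i` belongs to `x_i` and the index `Sum.inr j` to `y_j`. -/
structure AlmostCentralizingExtension (k R : Type*) [Field k] [Ring R] [Algebra k R]
    (m n : ℕ) where
  /-- the generators of `B` -/
  x : Fin m → R
  /-- the remaining generators -/
  y : Fin n → R
  /-- the polynomials `Q¹_{i,j}` -/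
  Q1 : Fin n → Fin m → MvPolynomial (Fin m) k
  /-- the polynomials `Q^{2,0}_{i,j}` -/
  Q20 : Fin n → Fin n → MvPolynomial (Fin m) k
  /-- the polynomials `Q^{2,ℓ}_{i,j}` -/
  Q2 : Fin n → Fin n → Fin n → MvPolynomial (Fin m) k
  x_comm : ∀ i j, x i * x j = x j * x i
  rel1 : ∀ i j, y i * x j - x j * y i = evalOrdered x (Q1 i j)
  rel2 : ∀ i j, y i * y j - y j * y i =
    evalOrdered x (Q20 i j) + ∑ l, evalOrdered x (Q2 i j l) * y l
  /-- the basis of standard monomials -/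
  basis : Module.Basis ((Fin m ⊕ Fin n) →₀ ℕ) k R
  basis_apply : ∀ e, basis e =
    orderedMonomial x (fun i => e (Sum.inl i)) * orderedMonomial y (fun j => e (Sum.inr j))

/-- The weight `w · e` of an exponent vector `e`. -/
def expWeight {σ : Type*} [Fintype σ] (w : σ → ℝ) (e : σ →₀ ℕ) : ℝ :=
  ∑ s, w s * (e s : ℝ)

namespace AlmostCentralizingExtension

variable {k R : Type*} [Field k] [Ring R] [Algebra k R] {m n : ℕ}

/-- The polynomial region `PR(R)`: the vectors `w = (u, v)` for which
`deg_w (x_j y_i) > deg_w Q¹_{i,j}` and `deg_w (y_i y_j) > deg_w Q²_{i,j}`, where the degree of an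
element is the largest weight of a monomial of its standard expression (`-∞` for `0`). -/
def polynomialRegion (E : AlmostCentralizingExtension k R m n) : Set (Fin m ⊕ Fin n → ℝ) :=
  {w | (∀ i j, ∀ a ∈ (E.Q1 i j).support,
          expWeight (fun s => w (Sum.inl s)) a < w (Sum.inr i) + w (Sum.inl j)) ∧
       (∀ i j, ∀ a ∈ (E.Q20 i j).support,
          expWeight (fun s => w (Sum.inl s)) a < w (Sum.inr i) + w (Sum.inr j)) ∧
       (∀ i j l, ∀ a ∈ (E.Q2 i j l).support,
          expWeight (fun s => w (Sum.inl s)) a + w (Sum.inr l) <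
            w (Sum.inr i) + w (Sum.inr j))}

open Classical in
/-- The initial form `in_w(f)` in the commutative polynomial ring `S`: the sum of the terms of
maximal weight in the standard expression of `f`. -/
noncomputable def initialForm (E : AlmostCentralizingExtension k R m n)
    (w : Fin m ⊕ Fin n → ℝ) (f : R) : MvPolynomial (Fin m ⊕ Fin n) k :=
  ∑ e ∈ (E.basis.repr f).support with
      ∀ e' ∈ (E.basis.repr f).support, expWeight w e' ≤ expWeight w e,
    MvPolynomial.monomial e (E.basis.repr f e)

/-- `in_w(I)`: the `k`-span of the initial forms of the elements of the left ideal `I`. -/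
noncomputable def initialIdeal (E : AlmostCentralizingExtension k R m n)
    (I : Ideal R) (w : Fin m ⊕ Fin n → ℝ) :
    Submodule k (MvPolynomial (Fin m ⊕ Fin n) k) :=
  Submodule.span k {g | ∃ f ∈ I, g = E.initialForm w f}

/-- The equivalence class `C_I[w]`. -/
def equivClass (E : AlmostCentralizingExtension k R m n)
    (I : Ideal R) (w : Fin m ⊕ Fin n → ℝ) : Set (Fin m ⊕ Fin n → ℝ) :=
  {w' ∈ E.polynomialRegion | E.initialIdeal I w' = E.initialIdeal I w}

/-- The Gröbner region `GR(I)`: the vectors of the polynomial region that are equivalent to a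
positive vector of the polynomial region. -/
def groebnerRegion (E : AlmostCentralizingExtension k R m n) (I : Ideal R) :
    Set (Fin m ⊕ Fin n → ℝ) :=
  {w ∈ E.polynomialRegion | ∃ w' ∈ E.polynomialRegion, (∀ s, 0 < w' s) ∧
    E.initialIdeal I w = E.initialIdeal I w'}

/-- The cones that are closures of equivalence classes `C_I[w]`, for `w` in `GR(I)`. -/
def groebnerCones (E : AlmostCentralizingExtension k R m n) (I : Ideal R) :
    Set (PointedCone ℝ (Fin m ⊕ Fin n → ℝ)) :=
  {C | ∃ w ∈ E.groebnerRegion I, (C : Set (Fin m ⊕ Fin n → ℝ)) = closure (E.equivClass I w)}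

end AlmostCentralizingExtension

/-- A rational polyhedral cone: the solution set of finitely many homogeneous linear inequalities
with integer coefficients. -/
def IsRationalPolyhedralCone {σ : Type*} [Fintype σ] (C : PointedCone ℝ (σ → ℝ)) : Prop :=
  ∃ A : Finset (σ → ℤ), ∀ x : σ → ℝ, x ∈ C ↔ ∀ a ∈ A, 0 ≤ ∑ s, (a s : ℝ) * x s

/-- A rational fan: a nonempty finite collection of rational polyhedral cones which contains every
face of each of its members, and in which any two members intersect in a common face. -/
structure IsRationalFan {σ : Type*} [Fintype σ] (Δ : Set (PointedCone ℝ (σ → ℝ))) : Prop where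
  nonempty : Δ.Nonempty
  finite : Δ.Finite
  rational : ∀ C ∈ Δ, IsRationalPolyhedralCone C
  face_mem : ∀ C ∈ Δ, ∀ F : PointedCone ℝ (σ → ℝ), F.IsFaceOf C → F ∈ Δ
  inter_face : ∀ C ∈ Δ, ∀ C' ∈ Δ, (C ⊓ C').IsFaceOf C ∧ (C ⊓ C').IsFaceOf C'

/-! Standard monomials identify `R` with a space of polynomials and `I` with a subspace V. By
`mulLower`, left multiplication by a generator raises one exponent, up to terms that are lower for
every weight of the polynomial region at once. The geometry uses only this property, abstracted as
`FilteredSubspace`.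

Let w be a positive admissible weight, refined to a total order by a lexicographic tie-break. The
order is well-founded, so division works: each of the finitely many minimal leading exponents has a
monic reduced element, and applying the operators to these gives an adapted element h_β of V for
every leading exponent β. Consider the weights y for which the reduced elements still attain their
maximal weight at their leading exponents. Every element of V is a combination of the h_β with no
increase of weight, for all such y simultaneously (`exists_standard_representation`). Hence a
nonzero element of in_y(V) always has an exponent that is leading for w
(`exists_mem_leads_of_mem_initialSpan`), and in_z(V) = in_y(V) forces the reduced elements to have
equal initial forms at z and y. The class of w is therefore cut out by finitely many integral
equations and strict inequalities (`openCone_eq`), and its closure is the cone with weak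
inequalities.

Finiteness follows from the ascending chain condition on sets of exponents closed upwards
(`finite_leads`) and from the finitely many possible supports of initial forms of a fixed finite
family (`finite_initialSpan`).

For the fan property, let a and b lie in the cone of w and a + b in the cone of w'. Splitting top
components for a + b by their a-weight (`expWeight_eq_of_add_mem`) shows that a lies in the cone of
w', so intersections are faces. Finally, a small move in any direction from a weight equivalent to a
positive one lands in the class of a positive weight (`exists_eventually_mem_openCone`); moving into
the relative interior of a face that meets the Gröbner region identifies that face with a cone of
the fan. -/

namespace GroebnerFan

open Finsupp

/-! ### Weights of exponents and the total order refining them. -/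

section Weights

variable {σ : Type*} [Fintype σ]

/-- The pairing of an integer covector with a real vector. -/
def pairing (a : σ → ℤ) (x : σ → ℝ) : ℝ := ∑ s, (a s : ℝ) * x s

theorem pairing_add (a : σ → ℤ) (x y : σ → ℝ) :
    pairing a (x + y) = pairing a x + pairing a y := by
  simp [pairing, mul_add, Finset.sum_add_distrib]

theorem pairing_smul (a : σ → ℤ) (c : ℝ) (x : σ → ℝ) :
    pairing a (c • x) = c * pairing a x := by
  simp only [pairing, Pi.smul_apply, smul_eq_mul, Finset.mul_sum]
  exact Finset.sum_congr rfl fun s _ => by ring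

theorem pairing_sub (a : σ → ℤ) (x y : σ → ℝ) :
    pairing a (x - y) = pairing a x - pairing a y := by
  simp [pairing, mul_sub, Finset.sum_sub_distrib]

theorem pairing_neg_left (a : σ → ℤ) (x : σ → ℝ) :
    pairing (-a) x = - pairing a x := by
  simp [pairing]

theorem continuous_pairing (a : σ → ℤ) : Continuous (pairing a) := by
  unfold pairing; fun_prop

theorem expWeight_add_left (w w' : σ → ℝ) (e : σ →₀ ℕ) :
    expWeight (w + w') e = expWeight w e + expWeight w' e := by
  simp [expWeight, add_mul, Finset.sum_add_distrib]

theorem expWeight_smul_left (c : ℝ) (w : σ → ℝ) (e : σ →₀ ℕ) :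
    expWeight (c • w) e = c * expWeight w e := by
  simp [expWeight, Finset.mul_sum, mul_assoc]

theorem expWeight_add (w : σ → ℝ) (e e' : σ →₀ ℕ) :
    expWeight w (e + e') = expWeight w e + expWeight w e' := by
  simp [expWeight, mul_add, Finset.sum_add_distrib]

theorem expWeight_single (w : σ → ℝ) (s : σ) : expWeight w (single s 1) = w s := by
  classical
  simp only [expWeight, single_apply]
  rw [Finset.sum_eq_single s] <;> simp +contextual [eq_comm]

/-- The difference of two exponent vectors. -/
def expDiff (e e' : σ →₀ ℕ) : σ → ℤ := fun s => (e s : ℤ) - e' s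

theorem pairing_expDiff (e e' : σ →₀ ℕ) (w : σ → ℝ) :
    pairing (expDiff e e') w = expWeight w e - expWeight w e' := by
  simp only [pairing, expDiff, expWeight, ← Finset.sum_sub_distrib]
  exact Finset.sum_congr rfl fun s _ => by push_cast; ring

theorem finite_expWeight_le {w : σ → ℝ} (hw : ∀ s, 0 < w s) (c : ℝ) :
    {e : σ →₀ ℕ | expWeight w e ≤ c}.Finite := by
  classical
  refine (Set.finite_Icc 0 (equivFunOnFinite.symm fun s => ⌊c / w s⌋₊)).subset fun e he => ?_
  refine ⟨zero_le, fun s => ?_⟩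
  simp only [equivFunOnFinite_symm_apply_apply]
  apply Nat.le_floor
  rw [le_div_iff₀ (hw s), mul_comm]
  refine le_trans ?_ he
  exact Finset.single_le_sum (f := fun s => w s * (e s : ℝ))
    (fun t _ => mul_nonneg (hw t).le (Nat.cast_nonneg _)) (Finset.mem_univ s)

/-- An additive embedding of the exponent vectors in a linearly ordered monoid, used to break
ties. -/
noncomputable def tieBreak (e : σ →₀ ℕ) : Lex (Fin (Fintype.card σ) →₀ ℕ) :=
  toLex (equivMapDomain (Fintype.equivFin σ) e)

theorem tieBreak_add (e e' : σ →₀ ℕ) : tieBreak (e + e') = tieBreak e + tieBreak e' :=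
  congrArg toLex (map_add (Finsupp.domCongr (Fintype.equivFin σ)) e e')

theorem tieBreak_injective : Function.Injective (tieBreak (σ := σ)) := fun _ _ h =>
  (Finsupp.domCongr (M := ℕ) (Fintype.equivFin σ)).injective (toLex.injective h)

/-- The total order on exponent vectors refining the weight `w`. -/
noncomputable def orderKey (w : σ → ℝ) (e : σ →₀ ℕ) :
    ℝ ×ₗ Lex (Fin (Fintype.card σ) →₀ ℕ) :=
  toLex (expWeight w e, tieBreak e)

theorem orderKey_injective (w : σ → ℝ) : Function.Injective (orderKey w) := fun _ _ h =>
  tieBreak_injective (congrArg Prod.snd (toLex.injective h))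

theorem expWeight_le_of_orderKey_le {w : σ → ℝ} {e e' : σ →₀ ℕ}
    (h : orderKey w e ≤ orderKey w e') : expWeight w e ≤ expWeight w e' := by
  rcases Prod.Lex.toLex_le_toLex.1 h with h | h
  · exact h.le
  · exact h.1.le

theorem orderKey_lt_of_expWeight_lt {w : σ → ℝ} {e e' : σ →₀ ℕ}
    (h : expWeight w e < expWeight w e') : orderKey w e < orderKey w e' :=
  Prod.Lex.toLex_lt_toLex.2 (Or.inl h)

theorem orderKey_add_le {w : σ → ℝ} {e e' : σ →₀ ℕ} (h : orderKey w e ≤ orderKey w e')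
    (c : σ →₀ ℕ) : orderKey w (e + c) ≤ orderKey w (e' + c) := by
  rw [orderKey, orderKey, Prod.Lex.toLex_le_toLex]
  simp only [expWeight_add, tieBreak_add]
  rcases Prod.Lex.toLex_le_toLex.1 h with h | h
  · exact Or.inl (by simpa using h)
  · exact Or.inr ⟨by simpa using h.1, add_le_add_left h.2 _⟩

/-- Positivity leaves finitely many exponents below a given weight, so initial segments are finite
and their cardinality is a decreasing measure. -/
theorem wellFounded_orderKey {w : σ → ℝ} (hw : ∀ s, 0 < w s) :
    WellFounded fun e e' : σ →₀ ℕ => orderKey w e < orderKey w e' := by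
  have hfin : ∀ e, {e' : σ →₀ ℕ | orderKey w e' ≤ orderKey w e}.Finite := fun e =>
    (finite_expWeight_le hw (expWeight w e)).subset fun e' he' =>
      expWeight_le_of_orderKey_le he'
  refine Subrelation.wf (r := InvImage (· < ·)
    fun e => {e' : σ →₀ ℕ | orderKey w e' ≤ orderKey w e}.ncard) ?_ (InvImage.wf _ Nat.lt_wfRel.wf)
  intro e e' h
  refine Set.ncard_lt_ncard ⟨fun x hx => le_trans hx h.le, fun hs => ?_⟩ (hfin e')
  exact absurd (hs (le_refl (orderKey w e'))) (not_le.2 h)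

end Weights

/-! ### Multiplication by a variable. -/

section Shift

variable {σ k : Type*} [Field k]

/-- Multiplication of a vector by the variable `s`. -/
noncomputable def shift (s : σ) : ((σ →₀ ℕ) →₀ k) →ₗ[k] ((σ →₀ ℕ) →₀ k) :=
  lmapDomain k k fun e => e + single s 1

theorem shift_single (s : σ) (e : σ →₀ ℕ) (c : k) :
    shift s (single e c) = single (e + single s 1) c := by
  simp [shift, lmapDomain_apply, mapDomain_single]

theorem shift_apply_add (s : σ) (f : (σ →₀ ℕ) →₀ k) (e : σ →₀ ℕ) :
    shift s f (e + single s 1) = f e :=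
  mapDomain_apply (add_left_injective _) f e

theorem exists_of_mem_support_shift {s : σ} {f : (σ →₀ ℕ) →₀ k} {e' : σ →₀ ℕ}
    (h : e' ∈ (shift s f).support) : ∃ e ∈ f.support, e' = e + single s 1 := by
  classical
  obtain ⟨e, he, rfl⟩ := Finset.mem_image.1 (mapDomain_support h)
  exact ⟨e, he, rfl⟩

end Shift

/-! ### Initial forms, weight components and leading exponents. -/

section Vectors

variable {σ k : Type*} [Fintype σ] [Field k]

/-- The component of weight `t` of a vector. -/
noncomputable def weightPart (w : σ → ℝ) (t : ℝ) (f : (σ →₀ ℕ) →₀ k) : (σ →₀ ℕ) →₀ k :=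
  f.filter fun e => expWeight w e = t

theorem weightPart_apply (w : σ → ℝ) (t : ℝ) (f : (σ →₀ ℕ) →₀ k) (e : σ →₀ ℕ) :
    weightPart w t f e = if expWeight w e = t then f e else 0 := filter_apply _ _ _

theorem weightPart_add (w : σ → ℝ) (t : ℝ) (f g : (σ →₀ ℕ) →₀ k) :
    weightPart w t (f + g) = weightPart w t f + weightPart w t g := filter_add

theorem weightPart_smul (w : σ → ℝ) (t : ℝ) (c : k) (f : (σ →₀ ℕ) →₀ k) :
    weightPart w t (c • f) = c • weightPart w t f := filter_smul

/-- `e` is an exponent of maximal weight in `f`. -/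
def IsTop (w : σ → ℝ) (f : (σ →₀ ℕ) →₀ k) (e : σ →₀ ℕ) : Prop :=
  e ∈ f.support ∧ ∀ e' ∈ f.support, expWeight w e' ≤ expWeight w e

open Classical in
/-- The initial form of a vector with respect to a weight. -/
noncomputable def initial (w : σ → ℝ) (f : (σ →₀ ℕ) →₀ k) : (σ →₀ ℕ) →₀ k :=
  f.filter fun e => ∀ e' ∈ f.support, expWeight w e' ≤ expWeight w e

theorem mem_support_initial {w : σ → ℝ} {f : (σ →₀ ℕ) →₀ k} {e : σ →₀ ℕ} :
    e ∈ (initial w f).support ↔ IsTop w f e := by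
  classical
  rw [initial, support_filter, Finset.mem_filter, IsTop]

theorem initial_apply_of_isTop {w : σ → ℝ} {f : (σ →₀ ℕ) →₀ k} {e : σ →₀ ℕ}
    (h : IsTop w f e) : initial w f e = f e := by
  classical
  rw [initial, filter_apply, if_pos h.2]

theorem initial_zero (w : σ → ℝ) : initial w (0 : (σ →₀ ℕ) →₀ k) = 0 := by
  classical
  exact filter_zero _

theorem initial_congr {w w' : σ → ℝ} {f : (σ →₀ ℕ) →₀ k}
    (h : ∀ e, IsTop w f e ↔ IsTop w' f e) : initial w f = initial w' f := by
  ext e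
  by_cases he : IsTop w f e
  · rw [initial_apply_of_isTop he, initial_apply_of_isTop ((h e).1 he)]
  · rw [notMem_support_iff.1 (mt mem_support_initial.1 he),
      notMem_support_iff.1 (mt mem_support_initial.1 (mt (h e).2 he))]

theorem exists_isTop (w : σ → ℝ) {f : (σ →₀ ℕ) →₀ k} (hf : f ≠ 0) : ∃ e, IsTop w f e :=
  Finset.exists_max_image _ _ (support_nonempty_iff.2 hf)

theorem weightPart_eq_initial {w : σ → ℝ} {f : (σ →₀ ℕ) →₀ k} {e : σ →₀ ℕ}
    (h : IsTop w f e) : weightPart w (expWeight w e) f = initial w f := by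
  ext e'
  rw [weightPart_apply]
  by_cases he' : IsTop w f e'
  · rw [initial_apply_of_isTop he', if_pos (le_antisymm (h.2 _ he'.1) (he'.2 _ h.1))]
  · rw [notMem_support_iff.1 (mt mem_support_initial.1 he'), ite_eq_right_iff]
    intro heq
    by_contra hne
    exact he' ⟨mem_support_iff.2 hne, fun x hx => heq ▸ h.2 x hx⟩

theorem weightPart_eq_zero {w : σ → ℝ} {f : (σ →₀ ℕ) →₀ k} {t : ℝ}
    (h : ∀ e ∈ f.support, expWeight w e < t) : weightPart w t f = 0 := by
  ext e
  rw [weightPart_apply, coe_zero, Pi.zero_apply, ite_eq_right_iff]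
  intro heq
  by_contra hne
  exact (h e (mem_support_iff.2 hne)).ne heq

/-- `e` is the leading exponent of `f` for the total order refining `w`. -/
def IsLead (w : σ → ℝ) (f : (σ →₀ ℕ) →₀ k) (e : σ →₀ ℕ) : Prop :=
  e ∈ f.support ∧ ∀ e' ∈ f.support, orderKey w e' ≤ orderKey w e

theorem exists_isLead (w : σ → ℝ) {f : (σ →₀ ℕ) →₀ k} (hf : f ≠ 0) : ∃ e, IsLead w f e :=
  Finset.exists_max_image _ _ (support_nonempty_iff.2 hf)

theorem IsLead.isTop {w : σ → ℝ} {f : (σ →₀ ℕ) →₀ k} {e : σ →₀ ℕ} (h : IsLead w f e) :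
    IsTop w f e :=
  ⟨h.1, fun e' he' => expWeight_le_of_orderKey_le (h.2 e' he')⟩

theorem IsLead.smul {w : σ → ℝ} {f : (σ →₀ ℕ) →₀ k} {e : σ →₀ ℕ} (h : IsLead w f e)
    {c : k} (hc : c ≠ 0) : IsLead w (c • f) e := by
  unfold IsLead
  rw [support_smul_eq hc]
  exact h

theorem weightPart_shift (w : σ → ℝ) (s : σ) (t : ℝ) (f : (σ →₀ ℕ) →₀ k) :
    weightPart w (t + w s) (shift s f) = shift s (weightPart w t f) := by
  induction f using Finsupp.induction_linear with
  | zero => rw [map_zero, weightPart, weightPart, filter_zero, filter_zero, map_zero]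
  | add f g hf hg => rw [map_add, weightPart_add, hf, hg, weightPart_add, map_add]
  | single e c =>
    rw [shift_single, weightPart, weightPart]
    by_cases h : expWeight w e = t
    · rw [filter_single_of_pos (fun e => expWeight w e = t) h, filter_single_of_pos, shift_single]
      rw [expWeight_add, expWeight_single, h]
    · rw [filter_single_of_neg (fun e => expWeight w e = t) h, filter_single_of_neg, map_zero]
      rw [expWeight_add, expWeight_single]
      simpa using h

end Vectors

/-! ### Subspaces stable under multiplication by variables up to lower terms. -/

/-- A subspace of the space of polynomials stable under operators which multiply by the variables
up to terms whose weight is lower for every weight in an open rational cone. -/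
structure FilteredSubspace (k σ : Type*) [Field k] [Fintype σ] where
  /-- the operators -/
  op : σ → ((σ →₀ ℕ) →₀ k) →ₗ[k] ((σ →₀ ℕ) →₀ k)
  /-- the subspace -/
  space : Submodule k ((σ →₀ ℕ) →₀ k)
  /-- the inequalities that define the cone -/
  ineqs : Finset (σ → ℤ)
  op_mem : ∀ s, ∀ f ∈ space, op s f ∈ space
  exists_pos : ∃ p : σ → ℝ, (∀ a ∈ ineqs, 0 < pairing a p) ∧ ∀ s, 0 < p s
  lower : ∀ s e e', e' ∈ (op s (single e 1) - single (e + single s 1) 1).support →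
    ∀ w : σ → ℝ, (∀ a ∈ ineqs, 0 < pairing a w) → expWeight w e' < expWeight w (e + single s 1)

namespace FilteredSubspace

variable {σ k : Type*} [Fintype σ] [Field k] (D : FilteredSubspace k σ)

/-- The open cone of admissible weights. -/
def region : Set (σ → ℝ) := {w | ∀ a ∈ D.ineqs, 0 < pairing a w}

/-- The closed cone of weights. -/
def closedRegion : Set (σ → ℝ) := {w | ∀ a ∈ D.ineqs, 0 ≤ pairing a w}

/-- The positive admissible weights. -/
def positiveRegion : Set (σ → ℝ) := {w | w ∈ D.region ∧ ∀ s, 0 < w s}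

/-- The span of the initial forms of the elements of the subspace. -/
noncomputable def initialSpan (w : σ → ℝ) : Submodule k ((σ →₀ ℕ) →₀ k) :=
  Submodule.span k {g | ∃ f ∈ D.space, g = initial w f}

theorem region_subset_closedRegion : D.region ⊆ D.closedRegion := fun _ hw a ha => (hw a ha).le

variable {D}

theorem add_mem_closedRegion {x y : σ → ℝ} (hx : x ∈ D.closedRegion) (hy : y ∈ D.closedRegion) :
    x + y ∈ D.closedRegion := fun a ha => by
  rw [pairing_add]; exact add_nonneg (hx a ha) (hy a ha)

theorem exists_of_mem_support_op_sub {s : σ} {f : (σ →₀ ℕ) →₀ k} {e' : σ →₀ ℕ}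
    (h : e' ∈ (D.op s f - shift s f).support) :
    ∃ e ∈ f.support, ∀ w ∈ D.region, expWeight w e' < expWeight w (e + single s 1) := by
  classical
  have key : D.op s f - shift s f =
      f.sum fun e c => c • (D.op s (single e 1) - single (e + single s 1) 1) := by
    conv_lhs => rw [← LinearMap.sub_apply, ← f.sum_single, Finsupp.sum, map_sum]
    refine Finset.sum_congr rfl fun e _ => ?_
    rw [← mul_one (f e), ← smul_eq_mul, ← smul_single, map_smul, LinearMap.sub_apply, shift_single]
    simp
  rw [key] at h
  obtain ⟨e, he, he'⟩ := Finset.mem_biUnion.1 (support_sum h)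
  exact ⟨e, he, fun w hw => D.lower s e e' (support_smul he') w hw⟩

/-- A strict inequality on the open region becomes weak on the closed one, since adding a positive
multiple of an interior point enters the open region. -/
theorem expWeight_le_of_forall_lt {e e' : σ →₀ ℕ}
    (h : ∀ w ∈ D.region, expWeight w e' < expWeight w e) {y : σ → ℝ} (hy : y ∈ D.closedRegion) :
    expWeight y e' ≤ expWeight y e := by
  obtain ⟨p, hp, -⟩ := D.exists_pos
  by_contra! hlt
  have hq := h p hp
  set δ := expWeight y e' - expWeight y e with hδ
  set q := expWeight p e - expWeight p e' with hqdef
  have hqpos : 0 < q := sub_pos.2 hq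
  have hδpos : 0 < δ := sub_pos.2 hlt
  -- The multiple δ / q is chosen so that the gain along `p` exactly compensates the assumed defect
  -- δ at `y`.
  have hmem : y + (δ / q) • p ∈ D.region := fun a ha => by
    rw [pairing_add, pairing_smul]
    have h1 := mul_pos (div_pos hδpos hqpos) (hp a ha)
    have h2 := hy a ha
    linarith
  have := h _ hmem
  simp only [expWeight_add_left, expWeight_smul_left] at this
  have h3 : δ / q * q = δ := div_mul_cancel₀ _ hqpos.ne'
  have h4 : δ / q * q = δ / q * expWeight p e - δ / q * expWeight p e' := by rw [hqdef]; ring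
  linarith

theorem expWeight_op_le {y : σ → ℝ} (hy : y ∈ D.closedRegion) {f : (σ →₀ ℕ) →₀ k} {t : ℝ}
    (hf : ∀ e ∈ f.support, expWeight y e ≤ t) (s : σ) :
    ∀ e ∈ (D.op s f).support, expWeight y e ≤ t + y s := by
  classical
  intro e' he'
  have hsplit : D.op s f = (D.op s f - shift s f) + shift s f := by abel
  rw [hsplit] at he'
  rcases Finset.mem_union.1 (support_add he') with h | h
  · obtain ⟨e, he, hlt⟩ := exists_of_mem_support_op_sub h
    have := expWeight_le_of_forall_lt hlt hy
    rw [expWeight_add, expWeight_single] at this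
    linarith [hf e he]
  · obtain ⟨e, he, rfl⟩ := exists_of_mem_support_shift h
    rw [expWeight_add, expWeight_single]
    linarith [hf e he]

theorem weightPart_op {w : σ → ℝ} (hw : w ∈ D.region) {f : (σ →₀ ℕ) →₀ k} {t : ℝ}
    (hf : ∀ e ∈ f.support, expWeight w e ≤ t) (s : σ) :
    weightPart w (t + w s) (D.op s f) = shift s (weightPart w t f) := by
  have hsplit : D.op s f = (D.op s f - shift s f) + shift s f := by abel
  rw [hsplit, weightPart_add, weightPart_shift, weightPart_eq_zero, zero_add]
  intro e' he'
  obtain ⟨e, he, hlt⟩ := exists_of_mem_support_op_sub he'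
  have := hlt w hw
  rw [expWeight_add, expWeight_single] at this
  linarith [hf e he]

/-- The error terms are lower in weight itself, so the tie-break cannot promote them above the
shifted leading exponent. -/
theorem isLead_op {w : σ → ℝ} (hw : w ∈ D.region) {f : (σ →₀ ℕ) →₀ k} {β : σ →₀ ℕ}
    (hf : IsLead w f β) (s : σ) :
    IsLead w (D.op s f) (β + single s 1) ∧ D.op s f (β + single s 1) = f β := by
  classical
  have hsplit : D.op s f = (D.op s f - shift s f) + shift s f := by abel
  have hlow : ∀ e' ∈ (D.op s f - shift s f).support,
      expWeight w e' < expWeight w (β + single s 1) := by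
    intro e' he'
    obtain ⟨e, he, hlt⟩ := exists_of_mem_support_op_sub he'
    have h1 := hlt w hw
    have h2 := hf.isTop.2 e he
    rw [expWeight_add] at h1 ⊢
    linarith
  have hval : D.op s f (β + single s 1) = f β := by
    rw [hsplit, Finsupp.add_apply, shift_apply_add, add_eq_right]
    by_contra hne
    exact lt_irrefl _ (hlow _ (mem_support_iff.2 hne))
  refine ⟨⟨mem_support_iff.2 (hval ▸ mem_support_iff.1 hf.1), fun e' he' => ?_⟩, hval⟩
  rw [hsplit] at he'
  rcases Finset.mem_union.1 (support_add he') with h | h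
  · exact (orderKey_lt_of_expWeight_lt (hlow _ h)).le
  · obtain ⟨e, he, rfl⟩ := exists_of_mem_support_shift h
    exact orderKey_add_le (hf.2 e he) _

end FilteredSubspace

end GroebnerFan

namespace GroebnerFan

open Finsupp

/-! ### Reduced elements, standard representations and equivalence classes. -/

section Exponents

variable {σ k : Type*} [Field k]

/-- The minimal elements of a set of exponents. -/
def gens (L : Set (σ →₀ ℕ)) : Set (σ →₀ ℕ) := {α | Minimal (· ∈ L) α}

theorem gens_subset (L : Set (σ →₀ ℕ)) : gens L ⊆ L := fun _ h => h.1

/-- Dickson's lemma: minimal elements form an antichain in a well-quasi-order. -/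
theorem finite_gens [Finite σ] (L : Set (σ →₀ ℕ)) : (gens L).Finite :=
  WellQuasiOrderedLE.finite_of_isAntichain (setOfPred_minimal_antichain _)

theorem exists_of_mem_support_linearCombination {h : (σ →₀ ℕ) → (σ →₀ ℕ) →₀ k}
    {c : (σ →₀ ℕ) →₀ k} {e : σ →₀ ℕ} (he : e ∈ (linearCombination k h c).support) :
    ∃ β ∈ c.support, e ∈ (h β).support := by
  classical
  rw [linearCombination_apply] at he
  obtain ⟨β, hβ, hmem⟩ := Finset.mem_biUnion.1 (support_sum he)
  exact ⟨β, hβ, support_smul hmem⟩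

end Exponents

namespace FilteredSubspace

variable {σ k : Type*} [Fintype σ] [Field k] (D : FilteredSubspace k σ)

/-- The leading exponents of the elements of the subspace. -/
def leads (w : σ → ℝ) : Set (σ →₀ ℕ) := {e | ∃ f ∈ D.space, IsLead w f e}

/-- A monic element of the subspace with no exponent in `L` other than `α`. -/
def IsReduced (L : Set (σ →₀ ℕ)) (α : σ →₀ ℕ) (v : (σ →₀ ℕ) →₀ k) : Prop :=
  v ∈ D.space ∧ v α = 1 ∧ ∀ e ∈ v.support, e ∈ L → e = α

open Classical in
/-- A choice of a reduced element (zero if there is none). -/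
noncomputable def reduced (L : Set (σ →₀ ℕ)) (α : σ →₀ ℕ) : (σ →₀ ℕ) →₀ k :=
  if h : ∃ v, D.IsReduced L α v then h.choose else 0

variable {D} {w : σ → ℝ}

theorem add_single_mem_leads (hw : w ∈ D.region) {β : σ →₀ ℕ} (hβ : β ∈ D.leads w) (s : σ) :
    β + single s 1 ∈ D.leads w := by
  obtain ⟨f, hf, hlead⟩ := hβ
  exact ⟨_, D.op_mem s f hf, (isLead_op hw hlead s).1⟩

theorem exists_monic_of_mem_leads {β : σ →₀ ℕ} (hβ : β ∈ D.leads w) :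
    ∃ f ∈ D.space, IsLead w f β ∧ f β = 1 := by
  obtain ⟨f, hf, hlead⟩ := hβ
  have hne : f β ≠ 0 := mem_support_iff.1 hlead.1
  exact ⟨(f β)⁻¹ • f, D.space.smul_mem _ hf, hlead.smul (inv_ne_zero hne), by
    simp [hne]⟩

theorem exists_mem_leads {f : (σ →₀ ℕ) →₀ k} (hf : f ∈ D.space) (hne : f ≠ 0) :
    ∃ e ∈ f.support, e ∈ D.leads w ∧ IsLead w f e := by
  obtain ⟨e, he⟩ := exists_isLead w hne
  exact ⟨e, he.1, ⟨f, hf, he⟩, he⟩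

theorem exists_normalForm (hpos : ∀ s, 0 < w s) (e : σ →₀ ℕ) :
    ∃ r : (σ →₀ ℕ) →₀ k, single e 1 - r ∈ D.space ∧ (∀ e' ∈ r.support, e' ∉ D.leads w) := by
  classical
  induction e using (wellFounded_orderKey hpos).induction with
  | _ e ih =>
  by_cases he : e ∈ D.leads w
  · obtain ⟨f, hf, hlead, hone⟩ := exists_monic_of_mem_leads he
    choose! r hr using ih
    -- Modulo the subspace, the monomial of `e` is minus the tail of the monic element `f`; each
    -- tail monomial is replaced by its own normal form.
    refine ⟨-∑ e' ∈ f.support.erase e, f e' • r e', ?_, fun e' he' => ?_⟩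
    · have hf' : f = single e 1 + ∑ e' ∈ f.support.erase e, f e' • single e' 1 := by
        conv_lhs => rw [← f.sum_single, Finsupp.sum, ← Finset.add_sum_erase _ _ hlead.1, hone]
        simp
      have : single e 1 - -∑ e' ∈ f.support.erase e, f e' • r e' =
          f - ∑ e' ∈ f.support.erase e, f e' • (single e' 1 - r e') := by
        simp only [smul_sub, Finset.sum_sub_distrib]
        rw [eq_sub_of_add_eq hf'.symm]
        abel
      rw [this]
      refine D.space.sub_mem hf (D.space.sum_mem fun e' he' => D.space.smul_mem _ ?_)
      rw [Finset.mem_erase] at he'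
      exact (hr e' (lt_of_le_of_ne (hlead.2 _ he'.2)
        fun h => he'.1 (orderKey_injective w h))).1
    · rw [support_neg] at he'
      obtain ⟨e'', he'', hmem⟩ := Finset.mem_biUnion.1 (support_finsetSum he')
      rw [Finset.mem_erase] at he''
      exact (hr e'' (lt_of_le_of_ne (hlead.2 _ he''.2)
        fun h => he''.1 (orderKey_injective w h))).2 e' (support_smul hmem)
  · exact ⟨single e 1, by simp, fun e' he' => by
      rwa [Finset.mem_singleton.1 (support_single_subset he')]⟩

/-- The monomial of `α` minus its normal form is reduced. -/
theorem isReduced_reduced (hpos : ∀ s, 0 < w s) {α : σ →₀ ℕ} (hα : α ∈ D.leads w) :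
    D.IsReduced (D.leads w) α (D.reduced (D.leads w) α) := by
  have h : ∃ v, D.IsReduced (D.leads w) α v := by
    classical
    obtain ⟨r, hr, hr'⟩ := exists_normalForm (D := D) hpos α
    refine ⟨_, hr, ?_, fun e he hL => ?_⟩
    · have : r α = 0 := notMem_support_iff.1 fun h => hr' α h hα
      simp [this]
    · rcases Finset.mem_union.1 (support_sub he) with h | h
      · exact Finset.mem_singleton.1 (support_single_subset h)
      · exact absurd hL (hr' e h)
  rw [reduced, dif_pos h]
  exact h.choose_spec

/-- The leading exponent of `v` belongs to `leads w`, and `α` is the only such exponent in the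
support. -/
theorem IsReduced.isLead {α : σ →₀ ℕ} {v : (σ →₀ ℕ) →₀ k}
    (h : D.IsReduced (D.leads w) α v) : IsLead w v α := by
  have hne : v ≠ 0 := fun h0 => by simpa [h0] using h.2.1
  obtain ⟨e, he, hL, hlead⟩ := exists_mem_leads (w := w) h.1 hne
  rwa [← h.2.2 e he hL]

variable (D) in
/-- The closed cone of weights for which the leading exponents for `w` are of maximal weight in the
reduced elements. -/
def weakCone (w : σ → ℝ) : Set (σ → ℝ) :=
  {y ∈ D.closedRegion | ∀ α ∈ gens (D.leads w), ∀ e ∈ (D.reduced (D.leads w) α).support,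
    expWeight y e ≤ expWeight y α}

variable (D) in
/-- The relatively open cone of weights that give the same initial forms of the reduced elements
as `w`. -/
def openCone (w : σ → ℝ) : Set (σ → ℝ) :=
  {y ∈ D.region | ∀ α ∈ gens (D.leads w), ∀ e ∈ (D.reduced (D.leads w) α).support,
    (expWeight w e = expWeight w α → expWeight y e = expWeight y α) ∧
    (expWeight w e < expWeight w α → expWeight y e < expWeight y α)}

theorem openCone_subset_weakCone (hpos : ∀ s, 0 < w s) : D.openCone w ⊆ D.weakCone w := by
  refine fun y hy => ⟨D.region_subset_closedRegion hy.1, fun α hα e he => ?_⟩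
  have hle := (isReduced_reduced hpos (gens_subset _ hα)).isLead.isTop.2 e he
  rcases hle.eq_or_lt with h | h
  · exact ((hy.2 α hα e he).1 h).le
  · exact ((hy.2 α hα e he).2 h).le

theorem mem_openCone_self (hw : w ∈ D.region) : w ∈ D.openCone w :=
  ⟨hw, fun _ _ _ _ => ⟨id, id⟩⟩

variable (D) in
/-- A monic element of the subspace with leading exponent `β`, whose initial forms are controlled
in the cones of `w`. -/
structure IsAdapted (w : σ → ℝ) (β : σ →₀ ℕ) (h : (σ →₀ ℕ) →₀ k) : Prop where
  mem : h ∈ D.space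
  one : h β = 1
  isLead : IsLead w h β
  le : ∀ y ∈ D.weakCone w, ∀ e ∈ h.support, expWeight y e ≤ expWeight y β
  part : ∀ z ∈ D.openCone w,
    weightPart z (expWeight z β) h = weightPart w (expWeight w β) h

theorem isAdapted_reduced (hpos : ∀ s, 0 < w s) {α : σ →₀ ℕ} (hα : α ∈ gens (D.leads w)) :
    D.IsAdapted w α (D.reduced (D.leads w) α) := by
  have hr := isReduced_reduced hpos (gens_subset _ hα)
  refine ⟨hr.1, hr.2.1, hr.isLead, fun y hy => hy.2 α hα, fun z hz => ?_⟩
  ext e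
  rw [weightPart_apply, weightPart_apply]
  by_cases he : e ∈ (D.reduced (D.leads w) α).support
  · have hz' := hz.2 α hα e he
    have hle := hr.isLead.isTop.2 e he
    congr 1
    refine propext ⟨fun h => ?_, hz'.1⟩
    by_contra hne
    exact (hz'.2 (lt_of_le_of_ne hle hne)).ne h
  · rw [notMem_support_iff.1 he]; simp

/-- On the component of highest weight the operator is an honest shift, for every weight of the open
region, so control of that component is inherited. -/
theorem IsAdapted.op (hw : w ∈ D.region) (hpos : ∀ s, 0 < w s) {β : σ →₀ ℕ}
    {h : (σ →₀ ℕ) →₀ k} (hh : D.IsAdapted w β h) (s : σ) :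
    D.IsAdapted w (β + single s 1) (D.op s h) := by
  have hlead := isLead_op hw hh.isLead s
  refine ⟨D.op_mem s h hh.mem, hlead.2.trans hh.one, hlead.1, fun y hy => ?_, fun z hz => ?_⟩
  · rw [expWeight_add, expWeight_single]
    exact expWeight_op_le hy.1 (hh.le y hy) s
  · simp only [expWeight_add, expWeight_single]
    rw [weightPart_op hw (hh.le w (openCone_subset_weakCone hpos (mem_openCone_self hw))),
      weightPart_op hz.1 (hh.le z (openCone_subset_weakCone hpos hz)), hh.part z hz]

theorem exists_isAdapted (hw : w ∈ D.positiveRegion) {β : σ →₀ ℕ} (hβ : β ∈ D.leads w) :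
    ∃ h, D.IsAdapted w β h := by
  obtain ⟨α, hαβ, hα⟩ := exists_minimal_le_of_wellFoundedLT (· ∈ D.leads w) β hβ
  obtain ⟨γ, rfl⟩ := exists_add_of_le hαβ
  have key : ∀ γ β : σ →₀ ℕ, (∃ h, D.IsAdapted w β h) → ∃ h, D.IsAdapted w (β + γ) h := by
    intro γ
    induction γ using Finsupp.induction_linear with
    | zero => simp
    | add γ γ' h h' => exact fun β hβ => by rw [← add_assoc]; exact h' _ (h _ hβ)
    | single s n =>
      induction n with
      | zero => simp
      | succ n ih =>
        intro β hβ
        obtain ⟨h, hh⟩ := ih β hβ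
        rw [single_add, ← add_assoc]
        exact ⟨_, hh.op hw.1 hw.2 s⟩
  exact key γ α ⟨_, isAdapted_reduced hw.2 hα⟩

theorem exists_adapted_family (D : FilteredSubspace k σ) (hw : w ∈ D.positiveRegion) :
    ∃ h : (σ →₀ ℕ) → (σ →₀ ℕ) →₀ k, ∀ β ∈ D.leads w, D.IsAdapted w β (h β) := by
  choose! h hh using fun (β : σ →₀ ℕ) (hβ : β ∈ D.leads w) => exists_isAdapted hw hβ
  exact ⟨h, hh⟩

/-- Division by the adapted family, cancelling leading terms for `w`. The exponent cancelled at each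
stage occurs in the current element, and `h β` has no exponent of larger `y`-weight than `β`; so no
stage raises the `y`-weight, and one representation serves every `y` in the weak cone. -/
theorem exists_standard_representation (hpos : ∀ s, 0 < w s)
    {h : (σ →₀ ℕ) → (σ →₀ ℕ) →₀ k} (hh : ∀ β ∈ D.leads w, D.IsAdapted w β (h β))
    {f : (σ →₀ ℕ) →₀ k} (hf : f ∈ D.space) :
    ∃ c : (σ →₀ ℕ) →₀ k, (∀ β ∈ c.support, β ∈ D.leads w) ∧ linearCombination k h c = f ∧
      ∀ y ∈ D.weakCone w, ∀ β ∈ c.support, ∃ e ∈ f.support, expWeight y β ≤ expWeight y e := by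
  classical
  by_cases hne : f = 0
  · exact ⟨0, by simp, by simp [hne], by simp⟩
  obtain ⟨β, hβ⟩ := exists_isLead w hne
  induction β using (wellFounded_orderKey hpos).induction generalizing f with
  | _ β ih =>
  have hβL : β ∈ D.leads w := ⟨f, hf, hβ⟩
  have hβh := hh β hβL
  set f' := f - f β • h β with hf'
  have hmem : f' ∈ D.space := D.space.sub_mem hf (D.space.smul_mem _ hβh.mem)
  have hsub : ∀ e ∈ f'.support, e ∈ f.support ∨ e ∈ (h β).support := fun e he =>
    (Finset.mem_union.1 (support_sub he)).imp id fun h => support_smul h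
  have hzero : f' β = 0 := by simp [hf', hβh.one]
  obtain ⟨c, hc, hcf, hcw⟩ : ∃ c : (σ →₀ ℕ) →₀ k, (∀ β ∈ c.support, β ∈ D.leads w) ∧
      linearCombination k h c = f' ∧ ∀ y ∈ D.weakCone w, ∀ β ∈ c.support,
        ∃ e ∈ f'.support, expWeight y β ≤ expWeight y e := by
    by_cases hne' : f' = 0
    · exact ⟨0, by simp, by simp [hne'], by simp⟩
    · obtain ⟨β', hβ'⟩ := exists_isLead w hne'
      refine ih β' (lt_of_le_of_ne ?_ fun heq => ?_) hmem hne' hβ'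
      · rcases hsub β' hβ'.1 with h | h
        · exact hβ.2 _ h
        · exact hβh.isLead.2 _ h
      · exact mem_support_iff.1 hβ'.1 (orderKey_injective w heq ▸ hzero)
  refine ⟨c + single β (f β), fun γ hγ => ?_, ?_, fun y hy γ hγ => ?_⟩
  · rcases Finset.mem_union.1 (support_add hγ) with h | h
    · exact hc γ h
    · rwa [Finset.mem_singleton.1 (support_single_subset h)]
  · rw [map_add, hcf, linearCombination_single, hf', sub_add_cancel]
  · rcases Finset.mem_union.1 (support_add hγ) with h | h
    · obtain ⟨e, he, hle⟩ := hcw y hy γ h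
      rcases hsub e he with h' | h'
      · exact ⟨e, h', hle⟩
      · exact ⟨β, hβ.1, hle.trans (hβh.le y hy e h')⟩
    · rw [Finset.mem_singleton.1 (support_single_subset h)]
      exact ⟨β, hβ.1, le_rfl⟩

theorem exists_isTop_mem_leads (hw : w ∈ D.positiveRegion) {y : σ → ℝ} (hy : y ∈ D.weakCone w)
    {f : (σ →₀ ℕ) →₀ k} (hf : f ∈ D.space) (hne : f ≠ 0) :
    ∃ β ∈ D.leads w, IsTop y f β := by
  classical
  obtain ⟨h, hh⟩ := exists_adapted_family D hw
  obtain ⟨c, hc, rfl, -⟩ := exists_standard_representation hw.2 hh hf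
  have hc0 : c ≠ 0 := fun h0 => hne (by simp [h0])
  obtain ⟨β₀, hβ₀, hmax⟩ := exists_isTop y hc0
  -- Among the exponents of maximal `y`-weight take the largest for `w`. If `β` occurred in another
  -- `h γ`, then `γ` would have the same `y`-weight and be larger for `w`; so the coefficient at `β`
  -- cannot cancel.
  obtain ⟨β, hβ, hβmax⟩ := Finset.exists_max_image
    (c.support.filter fun β => expWeight y β = expWeight y β₀) (orderKey w)
    ⟨β₀, by simpa using mem_support_iff.1 hβ₀⟩
  rw [Finset.mem_filter] at hβ
  refine ⟨β, hc β hβ.1, mem_support_iff.2 ?_, fun e he => ?_⟩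
  · rw [linearCombination_apply, Finsupp.sum, finsetSum_apply, Finset.sum_eq_single β]
    · simpa [(hh β (hc β hβ.1)).one] using hβ.1
    · intro γ hγ hγβ
      refine smul_eq_zero_of_right (c γ) (notMem_support_iff.1 fun hmem => ?_)
      have h1 := (hh γ (hc γ hγ)).le y hy β hmem
      have h2 := hmax γ hγ
      have h3 := hβmax γ (Finset.mem_filter.2 ⟨hγ, le_antisymm h2 (hβ.2 ▸ h1)⟩)
      exact hγβ (orderKey_injective w (le_antisymm h3 ((hh γ (hc γ hγ)).isLead.2 β hmem)))
    · exact fun h => absurd hβ.1 h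
  · obtain ⟨γ, hγ, hmem⟩ := exists_of_mem_support_linearCombination he
    rw [hβ.2]
    exact ((hh γ (hc γ hγ)).le y hy e hmem).trans (hmax γ hγ)

/-- The homogeneous components of an element of `initialSpan` are top parts of elements of the
subspace. -/
theorem exists_weightPart_eq {y : σ → ℝ} {v : (σ →₀ ℕ) →₀ k} (hv : v ∈ D.initialSpan y) (t : ℝ) :
    ∃ f ∈ D.space, (∀ e ∈ f.support, expWeight y e ≤ t) ∧ weightPart y t f = weightPart y t v := by
  classical
  induction hv using Submodule.span_induction with
  | mem g hg =>
    obtain ⟨f, hf, rfl⟩ := hg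
    by_cases hne : weightPart y t (initial y f) = 0
    · exact ⟨0, D.space.zero_mem, by simp, by rw [hne]; exact filter_zero _⟩
    · obtain ⟨e, he⟩ := support_nonempty_iff.2 hne
      rw [mem_support_iff, weightPart_apply, ite_ne_right_iff] at he
      obtain ⟨rfl, he⟩ := he
      have htop := mem_support_initial.1 (mem_support_iff.2 he)
      refine ⟨f, hf, htop.2, ?_⟩
      rw [weightPart_eq_initial htop]
      ext e'
      rw [weightPart_apply]
      split_ifs with h
      · rfl
      · refine notMem_support_iff.1 fun h' => h ?_
        have h'' := mem_support_initial.1 h'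
        exact le_antisymm (htop.2 _ h''.1) (h''.2 _ htop.1)
  | zero => exact ⟨0, D.space.zero_mem, by simp, rfl⟩
  | add v v' _ _ h h' =>
    obtain ⟨f, hf, hft, hfv⟩ := h
    obtain ⟨f', hf', hft', hfv'⟩ := h'
    refine ⟨f + f', D.space.add_mem hf hf', fun e he => ?_, ?_⟩
    · exact (Finset.mem_union.1 (support_add he)).elim (hft e) (hft' e)
    · rw [weightPart_add, weightPart_add, hfv, hfv']
  | smul c v _ h =>
    obtain ⟨f, hf, hft, hfv⟩ := h
    exact ⟨c • f, D.space.smul_mem _ hf, fun e he => hft e (support_smul he), by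
      rw [weightPart_smul, weightPart_smul, hfv]⟩

/-- A homogeneous component of `v` is the top part of an element of the subspace, and such a top
part meets `leads w`. This replaces any comparison of leading exponents for `y` and `w`. -/
theorem exists_mem_leads_of_mem_initialSpan (hw : w ∈ D.positiveRegion) {y : σ → ℝ}
    (hy : y ∈ D.weakCone w) {v : (σ →₀ ℕ) →₀ k} (hv : v ∈ D.initialSpan y) (hne : v ≠ 0) :
    ∃ β ∈ D.leads w, β ∈ v.support := by
  obtain ⟨e, he⟩ := support_nonempty_iff.2 hne
  obtain ⟨f, hf, hft, hfv⟩ := exists_weightPart_eq hv (expWeight y e)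
  have hfe : e ∈ f.support := by
    have := DFunLike.congr_fun hfv e
    rw [weightPart_apply, weightPart_apply, if_pos rfl, if_pos rfl] at this
    rwa [mem_support_iff, this, ← mem_support_iff]
  obtain ⟨β, hβ, htop⟩ := exists_isTop_mem_leads hw hy hf
    (support_nonempty_iff.1 ⟨e, hfe⟩)
  have hβe : expWeight y β = expWeight y e := le_antisymm (hft β htop.1) (htop.2 e hfe)
  refine ⟨β, hβ, ?_⟩
  have := DFunLike.congr_fun hfv β
  rw [weightPart_apply, weightPart_apply, if_pos hβe, if_pos hβe] at this
  rw [mem_support_iff, ← this, ← mem_support_iff]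
  exact htop.1

theorem initial_mem_initialSpan {f : (σ →₀ ℕ) →₀ k} (hf : f ∈ D.space) (y : σ → ℝ) :
    initial y f ∈ D.initialSpan y := Submodule.subset_span ⟨f, hf, rfl⟩

/-- Weights with the same span of initial forms as a weight of the cone of `w` have the same
initial forms of the reduced elements for `w`. -/
theorem initial_reduced_eq (hw : w ∈ D.positiveRegion) {y z : σ → ℝ} (hy : y ∈ D.weakCone w)
    (hyz : D.initialSpan z = D.initialSpan y) {α : σ →₀ ℕ} {g : (σ →₀ ℕ) →₀ k}
    (hg : D.IsReduced (D.leads w) α g) :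
    initial z g = initial y g ∧ IsTop y g α ∧ IsTop z g α := by
  classical
  have hg0 : g ≠ 0 := fun h0 => by simpa [h0] using hg.2.1
  have htop : ∀ z, D.initialSpan z = D.initialSpan y → IsTop z g α := by
    intro z hz
    have hmem : initial z g ∈ D.initialSpan y := hz ▸ initial_mem_initialSpan hg.1 z
    obtain ⟨e, he⟩ := exists_isTop z hg0
    obtain ⟨β, hβ, hβg⟩ := exists_mem_leads_of_mem_initialSpan hw hy hmem
      (support_nonempty_iff.1 ⟨e, mem_support_initial.2 he⟩)
    have hβg := mem_support_initial.1 hβg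
    rwa [← hg.2.2 β hβg.1 hβ]
  have hy' := htop y rfl
  have hz' := htop z hyz
  refine ⟨?_, hy', hz'⟩
  by_contra hne
  have hmem : initial z g - initial y g ∈ D.initialSpan y :=
    Submodule.sub_mem _ (hyz ▸ initial_mem_initialSpan hg.1 z) (initial_mem_initialSpan hg.1 y)
  -- An exponent of the difference in `leads w` can only be `α`, but there both initial forms have
  -- the coefficient of `g`.
  obtain ⟨β, hβ, hβs⟩ := exists_mem_leads_of_mem_initialSpan hw hy hmem (sub_ne_zero.2 hne)
  have hβg : β ∈ g.support := by
    rcases Finset.mem_union.1 (support_sub hβs) with h | h <;> exact (mem_support_initial.1 h).1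
  obtain rfl := hg.2.2 β hβg hβ
  rw [mem_support_iff, Finsupp.sub_apply, initial_apply_of_isTop hy', initial_apply_of_isTop hz',
    sub_self] at hβs
  exact hβs rfl

/-- A standard representation does not raise the `y`-weight, so the top component of `f` is the
combination of those top components of the `h β` whose weight equals that of `f`. -/
theorem initialSpan_eq_span (hw : w ∈ D.positiveRegion) {h : (σ →₀ ℕ) → (σ →₀ ℕ) →₀ k}
    (hh : ∀ β ∈ D.leads w, D.IsAdapted w β (h β)) {y : σ → ℝ} (hy : y ∈ D.weakCone w) :
    D.initialSpan y =
      Submodule.span k ((fun β => weightPart y (expWeight y β) (h β)) '' D.leads w) := by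
  classical
  have hpart : ∀ β ∈ D.leads w, weightPart y (expWeight y β) (h β) = initial y (h β) :=
    fun β hβ => weightPart_eq_initial ⟨(hh β hβ).isLead.1, (hh β hβ).le y hy⟩
  apply le_antisymm
  · refine Submodule.span_le.2 ?_
    rintro _ ⟨f, hf, rfl⟩
    by_cases hne : f = 0
    · rw [hne, initial_zero]; exact Submodule.zero_mem _
    obtain ⟨e, he⟩ := exists_isTop y hne
    rw [← weightPart_eq_initial he]
    obtain ⟨c, hc, hcf, hcw⟩ := exists_standard_representation hw.2 hh hf
    have hexp : weightPart y (expWeight y e) f =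
        ∑ β ∈ c.support, c β • weightPart y (expWeight y e) (h β) := by
      rw [← hcf, linearCombination_apply, Finsupp.sum, weightPart, filter_sum]
      exact Finset.sum_congr rfl fun β _ => weightPart_smul _ _ _ _
    rw [hexp]
    refine Submodule.sum_mem _ fun β hβ => Submodule.smul_mem _ _ ?_
    obtain ⟨e', he', hle⟩ := hcw y hy β hβ
    rcases (hle.trans (he.2 e' he')).eq_or_lt with heq | hlt
    · rw [← heq]
      exact Submodule.subset_span ⟨β, hc β hβ, rfl⟩
    · rw [weightPart_eq_zero]
      · exact Submodule.zero_mem _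
      · exact fun x hx => ((hh β (hc β hβ)).le y hy x hx).trans_lt hlt
  · refine Submodule.span_le.2 ?_
    rintro _ ⟨β, hβ, rfl⟩
    simp only [hpart β hβ]
    exact initial_mem_initialSpan (hh β hβ).mem y

theorem initialSpan_eq_of_mem_openCone (hw : w ∈ D.positiveRegion) {z : σ → ℝ}
    (hz : z ∈ D.openCone w) : D.initialSpan z = D.initialSpan w := by
  obtain ⟨h, hh⟩ := exists_adapted_family D hw
  rw [initialSpan_eq_span hw hh (openCone_subset_weakCone hw.2 hz),
    initialSpan_eq_span hw hh (openCone_subset_weakCone hw.2 (mem_openCone_self hw.1))]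
  congr 1
  exact Set.image_congr fun β hβ => (hh β hβ).part z hz

theorem mem_openCone_of_initial_eq (hw : w ∈ D.positiveRegion) {z : σ → ℝ} (hz : z ∈ D.region)
    (hinit : ∀ α ∈ gens (D.leads w), initial z (D.reduced (D.leads w) α) =
      initial w (D.reduced (D.leads w) α)) : z ∈ D.openCone w := by
  refine ⟨hz, fun α hα e he => ?_⟩
  have hr := isReduced_reduced hw.2 (gens_subset _ hα)
  have hiff : ∀ e, IsTop z (D.reduced (D.leads w) α) e ↔
      IsTop w (D.reduced (D.leads w) α) e := fun e => by
    rw [← mem_support_initial, hinit α hα, mem_support_initial]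
  have hwα := hr.isLead.isTop
  have hzα := (hiff α).2 hwα
  refine ⟨fun h => ?_, fun h => ?_⟩
  · have : IsTop z (D.reduced (D.leads w) α) e := (hiff e).2 ⟨he, fun e' he' => h ▸ hwα.2 e' he'⟩
    exact le_antisymm (hzα.2 e he) (this.2 α hzα.1)
  · refine lt_of_le_of_ne (hzα.2 e he) fun heq => ?_
    have : IsTop w (D.reduced (D.leads w) α) e := (hiff e).1 ⟨he, fun e' he' => heq ▸ hzα.2 e' he'⟩
    exact absurd (this.2 α hwα.1) (not_le.2 h)

/-- One inclusion holds because the spanning initial forms of the adapted family are constant on the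
open cone; the other because the span determines the initial forms of the reduced elements. Only `w`
has to be positive. -/
theorem openCone_eq (hw : w ∈ D.positiveRegion) :
    D.openCone w = {z ∈ D.region | D.initialSpan z = D.initialSpan w} := by
  ext z
  refine ⟨fun hz => ⟨hz.1, initialSpan_eq_of_mem_openCone hw hz⟩, fun hz => ?_⟩
  refine mem_openCone_of_initial_eq hw hz.1 fun α hα => ?_
  exact (initial_reduced_eq hw (openCone_subset_weakCone hw.2 (mem_openCone_self hw.1)) hz.2
    (isReduced_reduced hw.2 (gens_subset _ hα))).1

end FilteredSubspace

end GroebnerFan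

namespace GroebnerFan

open Finsupp Filter Topology

/-! ### For small positive ε, the sign of q + ε r is the lexicographic sign of (q, r). -/

section Asymptotics

theorem eventually_add_mul_pos {q r : ℝ} (h : 0 < q ∨ q = 0 ∧ 0 < r) :
    ∀ᶠ ε in 𝓝[>] (0 : ℝ), 0 < q + ε * r := by
  rcases h with h | ⟨rfl, h⟩
  · have hc : Tendsto (fun ε : ℝ => q + ε * r) (𝓝 0) (𝓝 (q + 0 * r)) :=
      Continuous.tendsto (by fun_prop) 0
    rw [zero_mul, add_zero] at hc
    exact (hc.eventually (lt_mem_nhds h)).filter_mono nhdsWithin_le_nhds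
  · filter_upwards [self_mem_nhdsWithin] with ε hε
    rw [zero_add]
    exact mul_pos hε h

theorem pos_or_of_frequently_pos {q r : ℝ} (h : ∃ᶠ ε in 𝓝[>] (0 : ℝ), 0 < q + ε * r) :
    0 < q ∨ q = 0 ∧ 0 < r := by
  rcases lt_trichotomy q 0 with hq | hq | hq
  · have := eventually_add_mul_pos (q := -q) (r := -r) (Or.inl (neg_pos.2 hq))
    obtain ⟨ε, h1, h2⟩ := (h.and_eventually this).exists
    linarith
  · refine Or.inr ⟨hq, ?_⟩
    obtain ⟨ε, h1, h2⟩ := (h.and_eventually self_mem_nhdsWithin).exists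
    rw [hq, zero_add] at h1
    exact (pos_iff_pos_of_mul_pos h1).1 h2
  · exact Or.inl hq

theorem eq_zero_of_frequently_eq_zero {q r : ℝ} (h : ∃ᶠ ε in 𝓝[>] (0 : ℝ), q + ε * r = 0) :
    q = 0 ∧ r = 0 := by
  have hq : q = 0 := by
    by_contra hq
    rcases lt_or_gt_of_ne hq with hq | hq
    · have := eventually_add_mul_pos (q := -q) (r := -r) (Or.inl (neg_pos.2 hq))
      obtain ⟨ε, h1, h2⟩ := (h.and_eventually this).exists
      linarith
    · obtain ⟨ε, h1, h2⟩ := (h.and_eventually (eventually_add_mul_pos (r := r) (Or.inl hq))).exists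
      linarith
  refine ⟨hq, ?_⟩
  obtain ⟨ε, h1, h2⟩ := (h.and_eventually self_mem_nhdsWithin).exists
  rw [hq, zero_add] at h1
  exact (mul_eq_zero.1 h1).resolve_left (ne_of_gt h2)

end Asymptotics

/-! ### Rational polyhedral cones and their faces. -/

section Polyhedral

variable {σ : Type*} [Fintype σ]

/-- The polyhedral cone of the solutions of the equations `A` and the inequalities `B`. -/
def polyCone (A B : Set (σ → ℤ)) : PointedCone ℝ (σ → ℝ) where
  carrier := {x | (∀ a ∈ A, pairing a x = 0) ∧ ∀ b ∈ B, 0 ≤ pairing b x}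
  add_mem' {x y} hx hy := ⟨fun a ha => by rw [pairing_add, hx.1 a ha, hy.1 a ha, add_zero],
    fun b hb => by rw [pairing_add]; exact add_nonneg (hx.2 b hb) (hy.2 b hb)⟩
  zero_mem' := by simp [pairing]
  smul_mem' c x hx := by
    have hc : c • x = (c : ℝ) • x := rfl
    refine ⟨fun a ha => ?_, fun b hb => ?_⟩
    · rw [hc, pairing_smul, hx.1 a ha, mul_zero]
    · rw [hc, pairing_smul]; exact mul_nonneg c.2 (hx.2 b hb)

theorem mem_polyCone {A B : Set (σ → ℤ)} {x : σ → ℝ} :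
    x ∈ polyCone A B ↔ (∀ a ∈ A, pairing a x = 0) ∧ ∀ b ∈ B, 0 ≤ pairing b x := Iff.rfl

theorem isRationalPolyhedralCone_polyCone {A B : Set (σ → ℤ)} (hA : A.Finite) (hB : B.Finite) :
    IsRationalPolyhedralCone (polyCone A B) := by
  classical
  refine ⟨hA.toFinset ∪ hA.toFinset.image (fun a => -a) ∪ hB.toFinset, fun x => ?_⟩
  simp only [Finset.mem_union, Finset.mem_image, Set.Finite.mem_toFinset, mem_polyCone]
  constructor
  · rintro ⟨h1, h2⟩ a ((ha | ⟨a, ha, rfl⟩) | ha)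
    · exact (h1 a ha).ge
    · exact le_of_eq_of_le (by simp [h1 a ha]) (pairing_neg_left a x).ge
    · exact h2 a ha
  · intro h
    refine ⟨fun a ha => le_antisymm ?_ (h a (Or.inl (Or.inl ha))), fun b hb => h b (Or.inr hb)⟩
    have : 0 ≤ pairing (-a) x := h (-a) (Or.inl (Or.inr ⟨a, ha, rfl⟩))
    rw [pairing_neg_left] at this
    linarith

theorem isClosed_polyCone (A B : Set (σ → ℤ)) :
    IsClosed (polyCone A B : Set (σ → ℝ)) := by
  have : (polyCone A B : Set (σ → ℝ)) =
      (⋂ a ∈ A, {x | pairing a x = 0}) ∩ ⋂ b ∈ B, {x | 0 ≤ pairing b x} := by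
    ext x; simp [mem_polyCone]
  rw [this]
  exact (isClosed_biInter fun a _ => isClosed_eq (continuous_pairing a) continuous_const).inter
    (isClosed_biInter fun b _ => isClosed_le continuous_const (continuous_pairing b))

/-- The relatively open polyhedral cone of the solutions of the equations `A` and the strict
inequalities `B`. -/
def openPolyCone (A B : Set (σ → ℤ)) : Set (σ → ℝ) :=
  {x | (∀ a ∈ A, pairing a x = 0) ∧ ∀ b ∈ B, 0 < pairing b x}

theorem openPolyCone_subset (A B : Set (σ → ℤ)) :
    openPolyCone A B ⊆ (polyCone A B : Set (σ → ℝ)) :=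
  fun _ hx => ⟨hx.1, fun b hb => (hx.2 b hb).le⟩

theorem closure_openPolyCone {A B : Set (σ → ℤ)} (hne : (openPolyCone A B).Nonempty) :
    closure (openPolyCone A B) = (polyCone A B : Set (σ → ℝ)) := by
  refine subset_antisymm ((isClosed_polyCone A B).closure_subset_iff.2 (openPolyCone_subset A B))
    fun x hx => ?_
  obtain ⟨p, hp⟩ := hne
  have ht : Tendsto (fun ε : ℝ => x + ε • p) (𝓝[>] 0) (𝓝 x) := by
    have hc : Tendsto (fun ε : ℝ => x + ε • p) (𝓝 0) (𝓝 (x + (0 : ℝ) • p)) :=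
      Continuous.tendsto (by fun_prop) 0
    rw [zero_smul, add_zero] at hc
    exact hc.mono_left nhdsWithin_le_nhds
  refine mem_closure_of_tendsto ht ?_
  filter_upwards [self_mem_nhdsWithin] with ε hε
  refine ⟨fun a ha => ?_, fun b hb => ?_⟩
  · rw [pairing_add, pairing_smul, hx.1 a ha, hp.1 a ha, mul_zero, add_zero]
  · rw [pairing_add, pairing_smul]
    exact add_pos_of_nonneg_of_pos (hx.2 b hb) (mul_pos hε (hp.2 b hb))

/-- If `p` satisfies strictly all the inequalities which are not equalities for `x`, then it can
be moved away from `x` inside the cone. -/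
theorem exists_sub_smul_mem {A B : Set (σ → ℤ)} (hB : B.Finite) {p x : σ → ℝ}
    (hp : p ∈ polyCone A B) (hx : ∀ a ∈ A, pairing a x = 0)
    (hpx : ∀ b ∈ B, pairing b x ≠ 0 → 0 < pairing b p) :
    ∃ ε : ℝ, 0 < ε ∧ p - ε • x ∈ polyCone A B := by
  have h : ∀ᶠ ε in 𝓝[>] (0 : ℝ), ∀ b ∈ B, 0 ≤ pairing b (p - ε • x) := by
    rw [eventually_all_finite hB]
    intro b hb
    by_cases hbx : pairing b x = 0
    · refine Eventually.of_forall fun ε => ?_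
      rw [pairing_sub, pairing_smul, hbx, mul_zero, sub_zero]
      exact hp.2 b hb
    · filter_upwards [eventually_add_mul_pos (r := -pairing b x) (Or.inl (hpx b hb hbx))] with ε hε
      rw [pairing_sub, pairing_smul]
      linarith
  obtain ⟨ε, hε, hpos⟩ := (h.and self_mem_nhdsWithin).exists
  refine ⟨ε, hpos, fun a ha => ?_, hε⟩
  rw [pairing_sub, pairing_smul, hp.1 a ha, hx a ha, mul_zero, sub_zero]

/-- Add up one witness for each inequality that does not vanish on `F`; all values are nonnegative,
so positivity survives the sums. -/
theorem exists_generic {A B : Set (σ → ℤ)} (hB : B.Finite) {F : PointedCone ℝ (σ → ℝ)}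
    (hF : F ≤ polyCone A B) :
    ∃ z ∈ F, ∀ b ∈ B, ∀ x ∈ F, pairing b x ≠ 0 → 0 < pairing b z := by
  induction B, hB using Set.Finite.induction_on generalizing A with
  | empty => exact ⟨0, F.zero_mem, by simp⟩
  | @insert b B _ _ ih =>
    have hnn : ∀ x ∈ F, ∀ c ∈ insert b B, 0 ≤ pairing c x := fun x hx => (hF hx).2
    obtain ⟨z, hz, hzB⟩ := ih (A := A)
      fun x hx => ⟨(hF hx).1, fun c hc => hnn x hx c (Set.mem_insert_of_mem _ hc)⟩
    by_cases hb : ∃ x ∈ F, pairing b x ≠ 0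
    · obtain ⟨x, hx, hxb⟩ := hb
      refine ⟨z + x, F.add_mem hz hx, fun c hc y hy hyc => ?_⟩
      rw [pairing_add]
      rcases Set.mem_insert_iff.1 hc with rfl | hc'
      · exact add_pos_of_nonneg_of_pos (hnn z hz c hc) (lt_of_le_of_ne (hnn x hx c hc) hxb.symm)
      · exact add_pos_of_pos_of_nonneg (hzB c hc' y hy hyc) (hnn x hx c hc)
    · push Not at hb
      refine ⟨z, hz, fun c hc y hy hyc => ?_⟩
      rcases Set.mem_insert_iff.1 hc with rfl | hc'
      · exact absurd (hb y hy) hyc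
      · exact hzB c hc' y hy hyc

/-- Turn into equations the inequalities that vanish on `F`. A generic point of `F` can be moved
away from any solution `x` within the cone, so the face property puts `x` in `F`. -/
theorem exists_eq_polyCone_of_isFaceOf {A B : Set (σ → ℤ)} (hB : B.Finite)
    {F : PointedCone ℝ (σ → ℝ)} (hF : F.IsFaceOf (polyCone A B)) :
    ∃ S ⊆ B, F = polyCone (A ∪ S) B := by
  obtain ⟨z, hz, hzB⟩ := exists_generic hB hF.le
  refine ⟨{b ∈ B | ∀ x ∈ F, pairing b x = 0}, fun b hb => hb.1, le_antisymm (fun x hx => ?_)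
    fun x hx => ?_⟩
  · refine ⟨?_, (hF.le hx).2⟩
    rintro a (ha | ha)
    · exact (hF.le hx).1 a ha
    · exact ha.2 x hx
  · have hx' : x ∈ polyCone A B := ⟨fun a ha => hx.1 a (Or.inl ha), hx.2⟩
    obtain ⟨ε, hε, hmem⟩ := exists_sub_smul_mem hB (hF.le hz) hx'.1 fun b hb hbx => by
      by_contra hbz
      refine hbx (hx.1 b (Or.inr ⟨hb, fun y hy => ?_⟩))
      by_contra hy'
      exact hbz (hzB b hb y hy hy')
    exact hF.mem_of_smul_add_mem hx' hmem hε (by simpa using hz)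

theorem finite_faces {A B : Set (σ → ℤ)} (hB : B.Finite) :
    {F : PointedCone ℝ (σ → ℝ) | F.IsFaceOf (polyCone A B)}.Finite := by
  refine (hB.finite_subsets.image fun S => polyCone (A ∪ S) B).subset fun F hF => ?_
  obtain ⟨S, hS, rfl⟩ := exists_eq_polyCone_of_isFaceOf hB hF
  exact ⟨S, hS, rfl⟩

/-- A relative interior point of a polyhedral cone. -/
theorem exists_forall_sub_smul_mem {A B : Set (σ → ℤ)} (hB : B.Finite) :
    ∃ p ∈ polyCone A B, ∀ x ∈ polyCone A B, ∃ ε : ℝ, 0 < ε ∧ p - ε • x ∈ polyCone A B := by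
  obtain ⟨p, hp, hpB⟩ := exists_generic hB (le_refl (polyCone A B))
  exact ⟨p, hp, fun x hx => exists_sub_smul_mem hB hp hx.1 fun b hb h => hpB b hb x hx h⟩

/-- If the inequalities `B` stay valid beyond every point of the ray from `x` in the direction `a`
where they are tight, then the ray is contained in the cone. -/
theorem pairing_nonneg_of_ray {B : Set (σ → ℤ)} (hB : B.Finite) {x a : σ → ℝ}
    (hx : ∀ b ∈ B, 0 ≤ pairing b x)
    (h : ∀ s : ℝ, 0 ≤ s → (∀ b ∈ B, 0 ≤ pairing b (x + s • a)) →
      ∀ b ∈ B, pairing b (x + s • a) = 0 → 0 ≤ pairing b a) :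
    ∀ b ∈ B, 0 ≤ pairing b a := by
  by_contra! hne
  -- Choose the inequality that becomes tight first along the ray; at that parameter all the others
  -- still hold.
  obtain ⟨b, ⟨hb, hba⟩, hmin⟩ := Set.exists_min_image {b ∈ B | pairing b a < 0}
    (fun b => pairing b x / (-pairing b a)) (hB.subset fun b hb => hb.1) hne
  set s := pairing b x / (-pairing b a) with hs
  have hs0 : 0 ≤ s := div_nonneg (hx b hb) (by linarith)
  refine absurd (h s hs0 (fun c hc => ?_) b hb ?_) (not_le.2 hba)
  · rw [pairing_add, pairing_smul]
    by_cases hca : pairing c a < 0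
    · have := hmin c ⟨hc, hca⟩
      rw [le_div_iff₀ (by linarith)] at this
      linarith
    · exact add_nonneg (hx c hc) (mul_nonneg hs0 (not_lt.1 hca))
  · have : s * (-pairing b a) = pairing b x := div_mul_cancel₀ _ (by linarith)
    rw [pairing_add, pairing_smul]
    linarith

end Polyhedral

/-! ### The ascending chain condition for upward closed sets. -/

section Dickson

/-- `UpperSet` is ordered by reverse inclusion, so a descending chain is an increasing chain of
sets. New elements chosen at each stage would form a sequence without an increasing pair. -/
theorem wellFounded_upperSet_lt (α : Type*) [Preorder α] [WellQuasiOrderedLE α] :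
    WellFounded ((· < ·) : UpperSet α → UpperSet α → Prop) := by
  rw [wellFounded_iff_isEmpty_descending_chain]
  refine ⟨fun ⟨f, hf⟩ => ?_⟩
  have hanti : Antitone f := antitone_nat_of_succ_le fun n => (hf n).le
  have hex : ∀ n, ∃ x, x ∈ f (n + 1) ∧ x ∉ f n := fun n =>
    Set.exists_of_ssubset (UpperSet.coe_ssubset_coe.2 (hf n))
  choose x hx hx' using hex
  obtain ⟨i, j, hij, hle⟩ := wellQuasiOrdered_le x
  exact hx' j (hanti (Nat.succ_le_of_lt hij) ((f (i + 1)).upper hle (hx i)))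

end Dickson

theorem finite_image_of_image {α β γ : Type*} {f : α → β} {g : α → γ} {s : Set α}
    (hf : (f '' s).Finite) (h : ∀ a ∈ s, ∀ b ∈ s, f a = f b → g a = g b) : (g '' s).Finite := by
  rcases isEmpty_or_nonempty α with hα | hα
  · exact (Set.toFinite s).image g
  refine (hf.image fun x => g (Function.invFunOn f s x)).subset ?_
  rintro _ ⟨a, ha, rfl⟩
  exact ⟨f a, ⟨a, ha, rfl⟩, h _ (Function.invFunOn_apply_mem ha) _ ha
    (Function.invFunOn_apply_eq ha)⟩

end GroebnerFan

namespace GroebnerFan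

open Finsupp Filter Topology

/-! ### The cones of positive weights and their fan. -/

namespace FilteredSubspace

variable {σ k : Type*} [Fintype σ] [Field k] (D : FilteredSubspace k σ)

/-- The equations of the cone of `w`. -/
def eqns (w : σ → ℝ) : Set (σ → ℤ) :=
  ⋃ α ∈ gens (D.leads w), ((D.reduced (D.leads w) α).support.filter
    fun e => expWeight w e = expWeight w α).image (fun e => expDiff α e)

/-- The inequalities of the cone of `w` that come from the reduced elements. -/
def strictIneqs (w : σ → ℝ) : Set (σ → ℤ) :=
  ⋃ α ∈ gens (D.leads w), ((D.reduced (D.leads w) α).support.filter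
    fun e => expWeight w e < expWeight w α).image (fun e => expDiff α e)

/-- The closed cone of `w`. -/
def cone (w : σ → ℝ) : PointedCone ℝ (σ → ℝ) := polyCone (D.eqns w) (D.ineqs ∪ D.strictIneqs w)

variable {D} {w : σ → ℝ}

theorem forall_mem_eqns {p : (σ → ℤ) → Prop} : (∀ a ∈ D.eqns w, p a) ↔
    ∀ α ∈ gens (D.leads w), ∀ e ∈ (D.reduced (D.leads w) α).support,
      expWeight w e = expWeight w α → p (expDiff α e) := by
  simp only [eqns, Set.mem_iUnion, Finset.coe_image, Set.mem_image, Finset.mem_coe,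
    Finset.mem_filter]
  constructor
  · exact fun h α hα e he heq => h _ ⟨α, hα, e, ⟨he, heq⟩, rfl⟩
  · rintro h _ ⟨α, hα, e, ⟨he, heq⟩, rfl⟩
    exact h α hα e he heq

theorem forall_mem_strictIneqs {p : (σ → ℤ) → Prop} : (∀ a ∈ D.strictIneqs w, p a) ↔
    ∀ α ∈ gens (D.leads w), ∀ e ∈ (D.reduced (D.leads w) α).support,
      expWeight w e < expWeight w α → p (expDiff α e) := by
  simp only [strictIneqs, Set.mem_iUnion, Finset.coe_image, Set.mem_image, Finset.mem_coe,
    Finset.mem_filter]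
  constructor
  · exact fun h α hα e he heq => h _ ⟨α, hα, e, ⟨he, heq⟩, rfl⟩
  · rintro h _ ⟨α, hα, e, ⟨he, heq⟩, rfl⟩
    exact h α hα e he heq

theorem finite_eqns (w : σ → ℝ) : (D.eqns w).Finite :=
  (finite_gens _).biUnion fun _ _ => Finset.finite_toSet _

theorem finite_strictIneqs (w : σ → ℝ) : (D.strictIneqs w).Finite :=
  (finite_gens _).biUnion fun _ _ => Finset.finite_toSet _

theorem finite_ineqs_union (w : σ → ℝ) :
    ((D.ineqs : Set (σ → ℤ)) ∪ D.strictIneqs w).Finite :=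
  (Finset.finite_toSet _).union (finite_strictIneqs w)

theorem openCone_eq_openPolyCone (w : σ → ℝ) :
    D.openCone w = openPolyCone (D.eqns w) (D.ineqs ∪ D.strictIneqs w) := by
  ext y
  simp only [openCone, openPolyCone, Set.mem_ofPred_eq, Set.mem_union, or_imp, forall_and,
    forall_mem_eqns, forall_mem_strictIneqs, pairing_expDiff, sub_eq_zero, sub_pos, region,
    Finset.mem_coe]
  constructor
  · exact fun h => ⟨fun α hα e he heq => (h.2.1 α hα e he heq).symm, h.1, h.2.2⟩
  · exact fun h => ⟨h.2.1, fun α hα e he heq => (h.1 α hα e he heq).symm, h.2.2⟩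

theorem mem_cone {y : σ → ℝ} : y ∈ D.cone w ↔ y ∈ D.closedRegion ∧
    ∀ α ∈ gens (D.leads w), ∀ e ∈ (D.reduced (D.leads w) α).support,
    (expWeight w e = expWeight w α → expWeight y e = expWeight y α) ∧
    (expWeight w e < expWeight w α → expWeight y e ≤ expWeight y α) := by
  simp only [cone, mem_polyCone, Set.mem_union, or_imp, forall_and,
    forall_mem_eqns, forall_mem_strictIneqs, pairing_expDiff, sub_eq_zero, sub_nonneg,
    closedRegion, Finset.mem_coe, Set.mem_ofPred_eq]
  constructor
  · exact fun h => ⟨h.2.1, fun α hα e he heq => (h.1 α hα e he heq).symm, h.2.2⟩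
  · exact fun h => ⟨fun α hα e he heq => (h.2.1 α hα e he heq).symm, h.1, h.2.2⟩

theorem cone_subset_weakCone (hpos : ∀ s, 0 < w s) {y : σ → ℝ} (hy : y ∈ D.cone w) :
    y ∈ D.weakCone w := by
  rw [mem_cone] at hy
  refine ⟨hy.1, fun α hα e he => ?_⟩
  rcases ((isReduced_reduced hpos (gens_subset _ hα)).isLead.isTop.2 e he).eq_or_lt with h | h
  · exact ((hy.2 α hα e he).1 h).le
  · exact (hy.2 α hα e he).2 h

theorem closure_openCone (hw : w ∈ D.region) :
    closure (D.openCone w) = (D.cone w : Set (σ → ℝ)) := by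
  rw [openCone_eq_openPolyCone, closure_openPolyCone, cone]
  exact ⟨w, openCone_eq_openPolyCone (D := D) w ▸ mem_openCone_self hw⟩

theorem openCone_subset_cone : D.openCone w ⊆ D.cone w := by
  rw [openCone_eq_openPolyCone]
  exact openPolyCone_subset _ _

theorem add_mem_weakCone {x y : σ → ℝ} (hx : x ∈ D.weakCone w) (hy : y ∈ D.weakCone w) :
    x + y ∈ D.weakCone w :=
  ⟨add_mem_closedRegion hx.1 hy.1, fun α hα e he => by
    rw [expWeight_add_left, expWeight_add_left]
    exact add_le_add (hx.2 α hα e he) (hy.2 α hα e he)⟩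

theorem smul_mem_weakCone {x : σ → ℝ} (hx : x ∈ D.weakCone w) {c : ℝ} (hc : 0 ≤ c) :
    c • x ∈ D.weakCone w :=
  ⟨fun a ha => by rw [pairing_smul]; exact mul_nonneg hc (hx.1 a ha), fun α hα e he => by
    rw [expWeight_smul_left, expWeight_smul_left]
    exact mul_le_mul_of_nonneg_left (hx.2 α hα e he) hc⟩

/-- The terms of maximal weight for `a + b` in a reduced element for `w'` have the same weights for
`a` if `a` and `b` lie in the cone of `w` and `a + b` in the cone of `w'`. -/
theorem expWeight_eq_of_add_mem {w w' : σ → ℝ} (hw : w ∈ D.positiveRegion)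
    (hw' : w' ∈ D.positiveRegion) {a b : σ → ℝ} (ha : a ∈ D.weakCone w) (hb : b ∈ D.weakCone w)
    (hab : a + b ∈ D.weakCone w') {α e : σ →₀ ℕ} {g : (σ →₀ ℕ) →₀ k}
    (hg : D.IsReduced (D.leads w') α g) (hα : IsTop (a + b) g α) (he : e ∈ g.support)
    (heα : expWeight (a + b) e = expWeight (a + b) α) : expWeight a e = expWeight a α := by
  classical
  obtain ⟨h, hh⟩ := exists_adapted_family D hw
  obtain ⟨c, hc, hcg, hcw⟩ := exists_standard_representation hw.2 hh hg.1
  have hxw : a + b ∈ D.weakCone w := add_mem_weakCone ha hb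
  have hdeg : ∀ β ∈ c.support, expWeight (a + b) β ≤ expWeight (a + b) α := fun β hβ => by
    obtain ⟨e', he', hle⟩ := hcw _ hxw β hβ
    exact hle.trans (hα.2 e' he')
  -- Keep the terms of top weight for `a + b` whose `a`-weight is that of `e`: this extracts a
  -- component homogeneous for both `a` and `b`.
  set c' := c.filter fun β => expWeight (a + b) β = expWeight (a + b) α ∧
    expWeight a β = expWeight a e with hc'
  set g' := linearCombination k h c' with hg'
  have hc'c : ∀ β ∈ c'.support, β ∈ c.support ∧ expWeight (a + b) β = expWeight (a + b) α ∧
      expWeight a β = expWeight a e := fun β hβ => by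
    rwa [hc', support_filter, Finset.mem_filter] at hβ
  -- The bounds for `a` and for `b` add up to an equality, so each is an equality.
  have htight : ∀ x, expWeight (a + b) x = expWeight (a + b) α → ∀ β ∈ c.support,
      x ∈ (h β).support → expWeight (a + b) β = expWeight (a + b) α ∧
        expWeight a β = expWeight a x := by
    intro x hx β hβ hmem
    have h1 := (hh β (hc β hβ)).le a ha x hmem
    have h2 := (hh β (hc β hβ)).le b hb x hmem
    have h3 := hdeg β hβ
    simp only [expWeight_add_left] at hx h3 ⊢
    constructor <;> linarith
  have hval : ∀ x, expWeight (a + b) x = expWeight (a + b) α →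
      g' x = if expWeight a x = expWeight a e then g x else 0 := by
    intro x hx
    rw [hg', ← hcg, linearCombination_apply, linearCombination_apply, Finsupp.sum, Finsupp.sum,
      finsetSum_apply, finsetSum_apply]
    simp only [Finsupp.smul_apply, hc', support_filter]
    rw [Finset.sum_filter]
    split_ifs with hxe
    · refine Finset.sum_congr rfl fun β hβ => ?_
      by_cases hmem : x ∈ (h β).support
      · have := htight x hx β hβ hmem
        have h' : expWeight (a + b) β = expWeight (a + b) α ∧ expWeight a β = expWeight a e :=
          ⟨this.1, this.2.trans hxe⟩
        rw [if_pos h', filter_apply, if_pos h']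
      · rw [notMem_support_iff.1 hmem]; simp
    · refine Finset.sum_eq_zero fun β hβ => ?_
      by_cases hmem : x ∈ (h β).support
      · have := htight x hx β hβ hmem
        rw [if_neg]
        exact fun h' => hxe (this.2.symm.trans h'.2)
      · rw [notMem_support_iff.1 hmem]; simp
  have hg'mem : g' ∈ D.space := by
    rw [hg', linearCombination_apply]
    exact D.space.sum_mem fun β hβ => D.space.smul_mem _ (hh β (hc β (hc'c β hβ).1)).mem
  have heg' : e ∈ g'.support := by
    rw [mem_support_iff, hval e heα, if_pos rfl]
    exact mem_support_iff.1 he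
  -- The top part of `g'` for `a + b` has an exponent in `leads w'`. It occurs in `g`, hence is `α`,
  -- whereas every top exponent of `g'` has the `a`-weight of `e`.
  obtain ⟨β, hβ, htop⟩ := exists_isTop_mem_leads hw' hab hg'mem (support_nonempty_iff.1 ⟨e, heg'⟩)
  have hβα : expWeight (a + b) β = expWeight (a + b) α := by
    refine le_antisymm ?_ (heα ▸ htop.2 e heg')
    obtain ⟨γ, hγ, hmem⟩ := exists_of_mem_support_linearCombination htop.1
    exact ((hh γ (hc γ (hc'c γ hγ).1)).le _ hxw β hmem).trans (hc'c γ hγ).2.1.le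
  have hβv := mem_support_iff.1 htop.1
  rw [hval β hβα, ite_ne_right_iff] at hβv
  rw [← hg.2.2 β (mem_support_iff.2 hβv.2) hβ, hβv.1]

/-- Every constraint of the cone of `w'` that is tight at a point a + b + s a of that cone is
constant along `a`. The equations are tight already at s = 0, and no inequality can be the first to
fail along the ray. -/
theorem mem_cone_of_add_mem {w w' : σ → ℝ} (hw : w ∈ D.positiveRegion)
    (hw' : w' ∈ D.positiveRegion) {a b : σ → ℝ} (ha : a ∈ D.cone w) (hb : b ∈ D.cone w)
    (hab : a + b ∈ D.cone w') : a ∈ D.cone w' := by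
  have ha' := cone_subset_weakCone hw.2 ha
  have hb' := cone_subset_weakCone hw.2 hb
  have haR : a ∈ D.closedRegion := ha'.1
  have key : ∀ s : ℝ, 0 ≤ s → a + b + s • a ∈ D.cone w' → ∀ α ∈ gens (D.leads w'),
      ∀ e ∈ (D.reduced (D.leads w') α).support,
      expWeight (a + b + s • a) e = expWeight (a + b + s • a) α →
      expWeight a e = expWeight a α := by
    intro s hs hmem α hα e he heq
    -- Both summands of (1 + s) a + b lie in the weak cone of `w`, and the factor 1 + s > 0 cancels
    -- afterwards.
    have h1 : a + b + s • a = (1 + s) • a + b := by rw [add_smul, one_smul]; abel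
    rw [h1] at hmem heq
    have hr := isReduced_reduced hw'.2 (gens_subset _ hα)
    have hweak := cone_subset_weakCone hw'.2 hmem
    have := expWeight_eq_of_add_mem hw hw' (smul_mem_weakCone ha' (by linarith : 0 ≤ 1 + s)) hb'
      hweak hr ⟨hr.isLead.1, hweak.2 α hα⟩ he heq
    rw [expWeight_smul_left, expWeight_smul_left] at this
    exact mul_left_cancel₀ (by linarith : (1 + s) ≠ 0) this
  have heqn : ∀ α ∈ gens (D.leads w'), ∀ e ∈ (D.reduced (D.leads w') α).support,
      expWeight w' e = expWeight w' α → expWeight a e = expWeight a α := by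
    intro α hα e he heq
    refine key 0 le_rfl (by rwa [zero_smul, add_zero]) α hα e he ?_
    rw [zero_smul, add_zero]
    exact ((mem_cone.1 hab).2 α hα e he).1 heq
  have hstrict : ∀ c ∈ D.strictIneqs w', 0 ≤ pairing c a := by
    refine pairing_nonneg_of_ray (finite_strictIneqs w') (x := a + b)
      (fun c hc => hab.2 c (Or.inr hc)) fun s hs hmem => ?_
    rw [forall_mem_strictIneqs]
    intro α hα e he hlt hzero
    have hcone : a + b + s • a ∈ D.cone w' := by
      refine ⟨?_, ?_⟩
      · rw [forall_mem_eqns]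
        intro α hα e he heq
        rw [pairing_add, pairing_smul, pairing_expDiff α e a, heqn α hα e he heq, sub_self,
          mul_zero, add_zero]
        exact hab.1 _ (forall_mem_eqns (p := fun x => x ∈ D.eqns w') |>.1 (fun _ h => h)
          α hα e he heq)
      · rintro c (hc | hc)
        · rw [pairing_add, pairing_smul]
          exact add_nonneg (hab.2 c (Or.inl hc)) (mul_nonneg hs (haR c hc))
        · exact hmem c hc
    rw [pairing_expDiff, sub_eq_zero] at hzero
    rw [pairing_expDiff, key s hs hcone α hα e he hzero.symm, sub_self]
  refine ⟨?_, ?_⟩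
  · rw [forall_mem_eqns]
    intro α hα e he heq
    rw [pairing_expDiff, heqn α hα e he heq, sub_self]
  · rintro c (hc | hc)
    · exact haR c hc
    · exact hstrict c hc

theorem inf_cone_isFaceOf {w w' : σ → ℝ} (hw : w ∈ D.positiveRegion)
    (hw' : w' ∈ D.positiveRegion) : (D.cone w ⊓ D.cone w').IsFaceOf (D.cone w) := by
  refine ⟨inf_le_left, fun {x y a} hx hy ha hmem => ⟨hx, ?_⟩⟩
  have h1 := mem_cone_of_add_mem hw hw' ((D.cone w).smul_mem ha.le hx) hy hmem.2
  have h2 := (D.cone w').smul_mem (inv_pos.2 ha).le h1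
  rwa [smul_smul, inv_mul_cancel₀ ha.ne', one_smul] at h2

theorem isUpperSet_leads (hw : w ∈ D.region) : IsUpperSet (D.leads w) := by
  intro β β' hle hβ
  obtain ⟨γ, rfl⟩ := exists_add_of_le hle
  have key : ∀ γ β : σ →₀ ℕ, β ∈ D.leads w → β + γ ∈ D.leads w := by
    intro γ
    induction γ using Finsupp.induction_linear with
    | zero => simp
    | add γ γ' h h' => exact fun β hβ => by rw [← add_assoc]; exact h' _ (h _ hβ)
    | single s n =>
      induction n with
      | zero => simp
      | succ n ih =>
        intro β hβ
        rw [single_add, ← add_assoc]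
        exact add_single_mem_leads hw (ih β hβ) s
  exact key γ β hβ

/-- If some `leads w` strictly contains `U`, it provides an element of the subspace with no exponent
in `U`. For any other weight, the leading exponent of this element is one of finitely many, and each
of them enlarges `U`; induct on `U` by the ascending chain condition. -/
theorem finite_leads (D : FilteredSubspace k σ) : (D.leads '' D.positiveRegion).Finite := by
  have key : ∀ U : UpperSet (σ →₀ ℕ), {L ∈ D.leads '' D.positiveRegion | ↑U ⊆ L}.Finite := by
    intro U
    induction U using (wellFounded_upperSet_lt (σ →₀ ℕ)).induction with
    | _ U ih =>
    by_cases hU : ∀ L ∈ D.leads '' D.positiveRegion, ↑U ⊆ L → L = U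
    · exact (Set.finite_singleton (U : Set (σ →₀ ℕ))).subset fun L hL => hU L hL.1 hL.2
    · push Not at hU
      obtain ⟨_, ⟨w, hw, rfl⟩, hsub, hne⟩ := hU
      obtain ⟨α, hα, hαU⟩ := Set.exists_of_ssubset (hsub.ssubset_of_ne hne.symm)
      have hr := isReduced_reduced hw.2 hα
      set f := D.reduced (D.leads w) α
      have hf0 : f ≠ 0 := fun h0 => by simpa [h0] using hr.2.1
      have hfU : ∀ e ∈ f.support, e ∉ U := fun e he heU => hαU (hr.2.2 e he (hsub heU) ▸ heU)
      refine (Set.Finite.biUnion f.support.finite_toSet fun e he =>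
        ih (U ⊓ UpperSet.Ici e) (lt_of_le_of_ne inf_le_left fun heq => hfU e he ?_)).subset ?_
      · rw [← heq]
        exact UpperSet.mem_inf_iff.2 (Or.inr (UpperSet.mem_Ici_iff.2 le_rfl))
      · rintro _ ⟨⟨w', hw', rfl⟩, hU'⟩
        obtain ⟨e, he, heL, -⟩ := exists_mem_leads (w := w') hr.1 hf0
        refine Set.mem_biUnion he ⟨⟨w', hw', rfl⟩, fun x hx => ?_⟩
        rcases UpperSet.mem_inf_iff.1 hx with h | h
        · exact hU' h
        · exact isUpperSet_leads hw'.1 (UpperSet.mem_Ici_iff.1 h) heL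
  -- In `UpperSet` the top element is the empty set, which imposes no condition.
  refine (key ⊤).subset fun L hL => ⟨hL, ?_⟩
  simp

theorem initial_eq_of_support_eq {w w' : σ → ℝ} {f : (σ →₀ ℕ) →₀ k}
    (h : (initial w f).support = (initial w' f).support) : initial w f = initial w' f :=
  initial_congr fun e => by rw [← mem_support_initial, h, mem_support_initial]

/-- The chosen reduced elements depend on the weight only through `L`. For fixed `L` the span is
determined by the supports of their initial forms, which are subsets of fixed finite sets. -/
theorem finite_initialSpan (D : FilteredSubspace k σ) :
    (D.initialSpan '' D.positiveRegion).Finite := by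
  classical
  have key : ∀ L ∈ D.leads '' D.positiveRegion,
      (D.initialSpan '' {w ∈ D.positiveRegion | D.leads w = L}).Finite := by
    intro L _
    have := (finite_gens L).to_subtype
    refine finite_image_of_image
      (f := fun w (α : gens L) => (initial w (D.reduced L α)).support) ?_ ?_
    · refine (Set.Finite.pi' (t := fun α : gens L => ((D.reduced L α).support.powerset : Set _))
        fun α => Finset.finite_toSet _).subset ?_
      rintro _ ⟨w, -, rfl⟩ α
      rw [Finset.mem_coe, Finset.mem_powerset]
      exact fun e he => (mem_support_initial.1 he).1
    · rintro w ⟨hw, rfl⟩ w' ⟨hw', hL⟩ heq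
      refine initialSpan_eq_of_mem_openCone hw' (mem_openCone_of_initial_eq hw' hw.1 ?_)
      intro α hα
      rw [hL] at hα ⊢
      exact initial_eq_of_support_eq (congrFun heq ⟨α, hα⟩)
  refine ((finite_leads D).biUnion key).subset ?_
  rintro _ ⟨w, hw, rfl⟩
  exact Set.mem_biUnion ⟨w, hw, rfl⟩ ⟨w, ⟨hw, rfl⟩, rfl⟩

theorem eventually_mem_region {z : σ → ℝ} (hz : z ∈ D.region) (d : σ → ℝ) :
    ∀ᶠ ε in 𝓝[>] (0 : ℝ), z + ε • d ∈ D.region := by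
  have : ∀ᶠ ε in 𝓝[>] (0 : ℝ), ∀ a ∈ D.ineqs, 0 < pairing a (z + ε • d) := by
    rw [Finset.eventually_all]
    intro a ha
    filter_upwards [eventually_add_mul_pos (r := pairing a d) (Or.inl (hz a ha))] with ε hε
    rwa [pairing_add, pairing_smul]
  exact this

theorem eventually_mem_positiveRegion {z : σ → ℝ} (hz : z ∈ D.positiveRegion) (d : σ → ℝ) :
    ∀ᶠ ε in 𝓝[>] (0 : ℝ), z + ε • d ∈ D.positiveRegion := by
  have : ∀ᶠ ε in 𝓝[>] (0 : ℝ), ∀ s, 0 < (z + ε • d) s := by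
    rw [eventually_all]
    exact fun s => eventually_add_mul_pos (r := d s) (Or.inl (hz.2 s))
  exact (eventually_mem_region hz.1 d).and this

/-- Small perturbations in a fixed direction of a weight that is equivalent to a positive weight
stay in the cone of one positive weight. -/
theorem exists_eventually_mem_openCone {z z' : σ → ℝ} (hz : z ∈ D.region)
    (hz' : z' ∈ D.positiveRegion) (hzz' : D.initialSpan z = D.initialSpan z') (d : σ → ℝ) :
    ∃ w ∈ D.positiveRegion, ∀ᶠ ε in 𝓝[>] (0 : ℝ), z + ε • d ∈ D.openCone w := by
  have hpos := eventually_mem_positiveRegion hz' d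
  -- Finitely many spans occur, so one of them recurs for arbitrarily small ε.
  obtain ⟨J, hJ⟩ : ∃ J, ∃ᶠ ε in 𝓝[>] (0 : ℝ), D.initialSpan (z' + ε • d) = J := by
    by_contra! hne
    have h1 : ∀ᶠ ε in 𝓝[>] (0 : ℝ), ∀ J ∈ D.initialSpan '' D.positiveRegion,
        ¬ D.initialSpan (z' + ε • d) = J :=
      (eventually_all_finite (finite_initialSpan D)).2 fun J _ => hne J
    obtain ⟨ε, h2, h3⟩ := (h1.and hpos).exists
    exact h2 _ ⟨_, h3, rfl⟩ rfl
  have hfreq := hJ.and_eventually hpos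
  obtain ⟨ε₀, hJ₀, hw⟩ := hfreq.exists
  set w := z' + ε₀ • d
  have hopen : ∃ᶠ ε in 𝓝[>] (0 : ℝ), z' + ε • d ∈ D.openCone w := hfreq.mono fun ε hε => by
    rw [openCone_eq hw]
    exact ⟨hε.2.1, hε.1.trans hJ₀.symm⟩
  have hexp : ∀ (x : σ → ℝ) (ε : ℝ) (e : σ →₀ ℕ),
      expWeight (x + ε • d) e = expWeight x e + ε * expWeight d e := fun x ε e => by
    rw [expWeight_add_left, expWeight_smul_left]
  have hsign : ∀ α ∈ gens (D.leads w), ∀ e ∈ (D.reduced (D.leads w) α).support,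
      (expWeight w e = expWeight w α → expWeight z' α - expWeight z' e = 0 ∧
        expWeight d α - expWeight d e = 0) ∧
      (expWeight w e < expWeight w α → 0 < expWeight z' α - expWeight z' e ∨
        expWeight z' α - expWeight z' e = 0 ∧ 0 < expWeight d α - expWeight d e) := by
    intro α hα e he
    refine ⟨fun h => eq_zero_of_frequently_eq_zero (hopen.mono fun ε hε => ?_),
      fun h => pos_or_of_frequently_pos (hopen.mono fun ε hε => ?_)⟩
    · have := (hε.2 α hα e he).1 h
      rw [hexp, hexp] at this
      linarith
    · have := (hε.2 α hα e he).2 h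
      rw [hexp, hexp] at this
      linarith
  have hz'w : z' ∈ D.weakCone w := by
    refine ⟨D.region_subset_closedRegion hz'.1, fun α hα e he => ?_⟩
    rcases ((isReduced_reduced hw.2 (gens_subset _ hα)).isLead.isTop.2 e he).eq_or_lt with h | h
    · linarith [((hsign α hα e he).1 h).1]
    · rcases (hsign α hα e he).2 h with h' | h'
      · linarith
      · linarith [h'.1]
  refine ⟨w, hw, ?_⟩
  have hgen : ∀ᶠ ε in 𝓝[>] (0 : ℝ), ∀ α ∈ gens (D.leads w),
      ∀ e ∈ (D.reduced (D.leads w) α).support,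
      (expWeight w e = expWeight w α → expWeight (z + ε • d) e = expWeight (z + ε • d) α) ∧
      (expWeight w e < expWeight w α → expWeight (z + ε • d) e < expWeight (z + ε • d) α) := by
    rw [eventually_all_finite (finite_gens _)]
    intro α hα
    rw [Finset.eventually_all]
    intro e he
    obtain ⟨hinit, htop', htop⟩ := initial_reduced_eq hw hz'w hzz'
      (isReduced_reduced hw.2 (gens_subset _ hα))
    -- Equal initial forms of the reduced elements at `z` and `z'` carry both vanishing and
    -- positivity of weight differences from `z'` to `z`.
    have hzero : expWeight z' α - expWeight z' e = 0 → expWeight z α - expWeight z e = 0 := by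
      intro h
      have h1 : IsTop z' (D.reduced (D.leads w) α) e :=
        ⟨he, fun x hx => (htop'.2 x hx).trans (by linarith)⟩
      have h2 : IsTop z (D.reduced (D.leads w) α) e := by
        rwa [← mem_support_initial, hinit, mem_support_initial]
      linarith [h2.2 α htop.1, htop.2 e he]
    have hlt : 0 < expWeight z' α - expWeight z' e → 0 < expWeight z α - expWeight z e := by
      intro h
      refine lt_of_le_of_ne (sub_nonneg.2 (htop.2 e he)) fun heq => ?_
      have h1 : IsTop z (D.reduced (D.leads w) α) e :=
        ⟨he, fun x hx => (htop.2 x hx).trans (by linarith)⟩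
      have h2 : IsTop z' (D.reduced (D.leads w) α) e := by
        rwa [← mem_support_initial, ← hinit, mem_support_initial]
      linarith [h2.2 α htop'.1]
    rcases ((isReduced_reduced hw.2 (gens_subset _ hα)).isLead.isTop.2 e he).eq_or_lt with h | h
    · have := (hsign α hα e he).1 h
      refine Eventually.of_forall fun ε => ⟨fun _ => ?_, fun h' => absurd h h'.ne⟩
      have h3 : ε * expWeight d α = ε * expWeight d e := by rw [sub_eq_zero.1 this.2]
      rw [hexp, hexp]
      linarith [hzero this.1]
    · have h1 : 0 < expWeight z α - expWeight z e ∨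
          expWeight z α - expWeight z e = 0 ∧ 0 < expWeight d α - expWeight d e :=
        ((hsign α hα e he).2 h).imp hlt fun h' => ⟨hzero h'.1, h'.2⟩
      filter_upwards [eventually_add_mul_pos h1] with ε hε
      refine ⟨fun h' => absurd h' h.ne, fun _ => ?_⟩
      rw [hexp, hexp]
      linarith
  exact (eventually_mem_region hz d).and hgen

variable (D) in
/-- The weights in the open cone equivalent to a positive one. -/
def groebnerRegion : Set (σ → ℝ) :=
  {w ∈ D.region | ∃ w' ∈ D.positiveRegion, D.initialSpan w = D.initialSpan w'}

variable (D) in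
/-- The cones of the positive admissible weights. -/
def cones : Set (PointedCone ℝ (σ → ℝ)) := D.cone '' D.positiveRegion

theorem exists_sub_smul_mem_cone {p x : σ → ℝ} (hp : p ∈ D.openCone w) (hx : x ∈ D.cone w) :
    ∃ ε : ℝ, 0 < ε ∧ p - ε • x ∈ D.cone w := by
  rw [openCone_eq_openPolyCone] at hp
  exact exists_sub_smul_mem (finite_ineqs_union w) (openPolyCone_subset _ _ hp) hx.1
    fun b hb _ => hp.2 b hb

theorem isFaceOf_mem_cones_iff {C F : PointedCone ℝ (σ → ℝ)} (hC : C ∈ D.cones)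
    (hF : F.IsFaceOf C) : F ∈ D.cones ↔ ((F : Set (σ → ℝ)) ∩ D.groebnerRegion).Nonempty := by
  constructor
  · rintro ⟨w, hw, rfl⟩
    exact ⟨w, openCone_subset_cone (mem_openCone_self hw.1), hw.1, w, hw, rfl⟩
  · rintro ⟨z, hzF, hz, z', hz', hzz'⟩
    obtain ⟨w, hw, rfl⟩ := hC
    obtain ⟨S, -, hS⟩ := exists_eq_polyCone_of_isFaceOf (finite_ineqs_union w) hF
    obtain ⟨p, hp, hpF⟩ := exists_forall_sub_smul_mem (A := D.eqns w ∪ S)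
      (finite_ineqs_union (D := D) w)
    rw [← hS] at hp hpF
    -- Here `p` is a relative interior point of `F`. The point z + ε p is then in the relative
    -- interior of `F` and also of the cone of `w'`, so face properties give both inclusions.
    obtain ⟨w', hw', hev⟩ := exists_eventually_mem_openCone hz hz' hzz' p
    obtain ⟨ε, hq, hε⟩ := (hev.and self_mem_nhdsWithin).exists
    replace hε : 0 < ε := hε
    have hsm : ∀ (c : ℝ), 0 ≤ c → ∀ x ∈ F, c • x ∈ F := fun c hc x hx => F.smul_mem hc hx
    have hqF : z + ε • p ∈ F := F.add_mem hzF (hsm ε hε.le p hp)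
    have hqG : z + ε • p ∈ D.cone w' ⊓ D.cone w := ⟨openCone_subset_cone hq, hF.le hqF⟩
    refine ⟨w', hw', le_antisymm (fun x hx => ?_) fun x hx => ?_⟩
    · obtain ⟨δ, hδ, hmem⟩ := exists_sub_smul_mem_cone hq hx
      have hface := inf_cone_isFaceOf hw' hw
      have hx' : x ∈ D.cone w :=
        (hface.mem_of_smul_add_mem hx hmem hδ (by simpa using hqG)).2
      have hy' : z + ε • p - δ • x ∈ D.cone w :=
        (hface.mem_of_smul_add_mem hmem ((D.cone w').smul_mem hδ.le hx) one_pos (by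
          rwa [one_smul, sub_add_cancel])).2
      exact hF.mem_of_smul_add_mem hx' hy' hδ (by simpa using hqF)
    · obtain ⟨δ, hδ, hmem⟩ := hpF x hx
      have hmem' : z + ε • p - (ε * δ) • x ∈ F := by
        have : z + ε • p - (ε * δ) • x = z + ε • (p - δ • x) := by
          rw [smul_sub, smul_smul]; abel
        rw [this]
        exact F.add_mem hzF (hsm ε hε.le _ hmem)
      exact ((inf_cone_isFaceOf hw hw').mem_of_smul_add_mem (hF.le hx) (hF.le hmem')
        (mul_pos hε hδ) (by simpa using hqG.symm)).2

theorem cone_eq_of_initialSpan_eq {w w' : σ → ℝ} (hw : w ∈ D.positiveRegion)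
    (hw' : w' ∈ D.positiveRegion) (h : D.initialSpan w = D.initialSpan w') :
    D.cone w = D.cone w' := by
  apply SetLike.coe_injective
  rw [← closure_openCone hw.1, ← closure_openCone hw'.1, openCone_eq hw, openCone_eq hw', h]

theorem finite_cones (D : FilteredSubspace k σ) : D.cones.Finite :=
  finite_image_of_image (finite_initialSpan D) fun _ hw _ hw' h =>
    cone_eq_of_initialSpan_eq hw hw' h

theorem isRationalFan_faces (D : FilteredSubspace k σ) :
    IsRationalFan {F | ∃ C ∈ D.cones, F.IsFaceOf C} where
  nonempty := by
    obtain ⟨p, hp⟩ := D.exists_pos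
    exact ⟨D.cone p, D.cone p, ⟨p, hp, rfl⟩, .refl _⟩
  finite := by
    have : {F : PointedCone ℝ (σ → ℝ) | ∃ C ∈ D.cones, F.IsFaceOf C} =
        ⋃ C ∈ D.cones, {F | F.IsFaceOf C} := by
      ext; simp
    rw [this]
    refine (finite_cones D).biUnion ?_
    rintro _ ⟨w, hw, rfl⟩
    exact finite_faces (finite_ineqs_union w)
  rational := by
    rintro F ⟨_, ⟨w, hw, rfl⟩, hF⟩
    obtain ⟨S, hS, rfl⟩ := exists_eq_polyCone_of_isFaceOf (finite_ineqs_union w) hF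
    exact isRationalPolyhedralCone_polyCone
      ((finite_eqns w).union ((finite_ineqs_union w).subset hS)) (finite_ineqs_union w)
  face_mem := fun C ⟨C', hC', hCC'⟩ F hF => ⟨C', hC', hF.trans hCC'⟩
  inter_face := by
    have key : ∀ C₁ ∈ D.cones, ∀ C₂ ∈ D.cones, ∀ F₁ F₂ : PointedCone ℝ (σ → ℝ),
        F₁.IsFaceOf C₁ → F₂.IsFaceOf C₂ → (F₁ ⊓ F₂).IsFaceOf F₁ := by
      rintro _ ⟨w₁, hw₁, rfl⟩ _ ⟨w₂, hw₂, rfl⟩ F₁ F₂ h₁ h₂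
      -- The intersection is a face of C₁ ∩ C₂, hence of C₁, hence of every face of C₁ that contains
      -- it.
      have h := (h₁.inf h₂).trans (inf_cone_isFaceOf hw₁ hw₂)
      exact (h.isFaceOf_iff_le h₁).2 inf_le_left
    rintro F₁ ⟨C₁, hC₁, h₁⟩ F₂ ⟨C₂, hC₂, h₂⟩
    exact ⟨key C₁ hC₁ C₂ hC₂ F₁ F₂ h₁ h₂, inf_comm F₂ F₁ ▸ key C₂ hC₂ C₁ hC₁ F₂ F₁ h₂ h₁⟩

end FilteredSubspace

end GroebnerFan

/-! ### Products of ordered monomials. -/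

section OrderedMonomial

variable {R : Type*} [Ring R]

theorem orderedMonomial_succ {p : ℕ} (z : Fin (p + 1) → R) (a : Fin (p + 1) → ℕ) :
    orderedMonomial z a =
      z 0 ^ a 0 * orderedMonomial (fun i => z i.succ) (fun i => a i.succ) := by
  simp [orderedMonomial, List.ofFn_succ]

theorem orderedMonomial_zero {p : ℕ} (z : Fin p → R) : orderedMonomial z 0 = 1 := by
  induction p with
  | zero => simp [orderedMonomial]
  | succ p ih =>
    rw [orderedMonomial_succ]
    exact (congrArg₂ (· * ·) (pow_zero _) (ih _)).trans (one_mul 1)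

theorem orderedMonomial_add {p : ℕ} {z : Fin p → R} (hz : ∀ i j, Commute (z i) (z j))
    (a b : Fin p → ℕ) :
    orderedMonomial z (a + b) = orderedMonomial z a * orderedMonomial z b := by
  induction p with
  | zero => simp [orderedMonomial]
  | succ p ih =>
    have h : Commute (orderedMonomial (fun i => z i.succ) fun i => a i.succ) (z 0 ^ b 0) := by
      refine Commute.list_prod_left _ _ fun y hy => ?_
      obtain ⟨i, rfl⟩ := List.mem_ofFn.1 hy
      exact (hz _ _).pow_pow _ _
    have ih' := ih (z := fun i => z i.succ) (fun i j => hz _ _) (fun i => a i.succ)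
      (fun i => b i.succ)
    rw [orderedMonomial_succ, orderedMonomial_succ z a, orderedMonomial_succ z b, Pi.add_apply,
      pow_add]
    calc z 0 ^ a 0 * z 0 ^ b 0 * orderedMonomial (fun i => z i.succ) (fun i => (a + b) i.succ)
        = z 0 ^ a 0 * z 0 ^ b 0 * (orderedMonomial (fun i => z i.succ) (fun i => a i.succ) *
          orderedMonomial (fun i => z i.succ) (fun i => b i.succ)) := by rw [← ih']; rfl
      _ = _ := by 
        simp only [mul_assoc]
        rw [← mul_assoc (z 0 ^ b 0), ← h.eq, mul_assoc]

theorem mul_orderedMonomial {p : ℕ} (z : Fin p → R) (i : Fin p) (b : Fin p → ℕ)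
    (hb : ∀ j < i, b j = 0) :
    z i * orderedMonomial z b = orderedMonomial z (b + Pi.single i 1) := by
  induction p with
  | zero => exact i.elim0
  | succ p ih =>
    rw [orderedMonomial_succ, orderedMonomial_succ]
    induction i using Fin.cases with
    | zero => simp [← mul_assoc, pow_succ']
    | succ i =>
      have h0 : b 0 = 0 := hb 0 (Fin.succ_pos i)
      have := ih (fun i => z i.succ) i (fun i => b i.succ)
        fun j hj => hb _ (Fin.succ_lt_succ_iff.2 hj)
      simp only [h0, Pi.add_apply, pow_zero, one_mul, ne_eq, (Fin.succ_ne_zero i).symm,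
        not_false_eq_true, Pi.single_eq_of_ne, add_zero]
      rw [this]
      congr 1
      ext j
      simp [Pi.single_apply]

end OrderedMonomial

/-! ### Multiplication of standard monomials by generators. -/

namespace AlmostCentralizingExtension

open Finsupp GroebnerFan

variable {k R : Type*} [Field k] [Ring R] [Algebra k R] {m n : ℕ}
  (E : AlmostCentralizingExtension k R m n)

/-- The generators, as one family. -/
def gen : Fin m ⊕ Fin n → R := Sum.elim E.x E.y

/-- An exponent vector in the variables `x`, seen as one in all the variables. -/
noncomputable def xExp (n : ℕ) {m : ℕ} (a : Fin m →₀ ℕ) : (Fin m ⊕ Fin n) →₀ ℕ :=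
  a.mapDomain Sum.inl

theorem xExp_inl (a : Fin m →₀ ℕ) (i : Fin m) : xExp n a (Sum.inl i) = a i :=
  mapDomain_apply Sum.inl_injective _ _

theorem xExp_inr (a : Fin m →₀ ℕ) (j : Fin n) : xExp n a (Sum.inr j) = 0 :=
  mapDomain_of_notMem_range _ _ (by simp)

theorem xExp_single (i : Fin m) : xExp n (single i 1) = single (Sum.inl i) 1 :=
  mapDomain_single

theorem expWeight_xExp (w : Fin m ⊕ Fin n → ℝ) (a : Fin m →₀ ℕ) :
    expWeight w (xExp n a) = expWeight (fun s => w (Sum.inl s)) a := by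
  simp [expWeight, xExp_inl, xExp_inr]

/-- The `x` generators commute and stand on the left, so there is no correction term. -/
theorem xMonomial_mul_basis (a : Fin m →₀ ℕ) (e : (Fin m ⊕ Fin n) →₀ ℕ) :
    orderedMonomial E.x a * E.basis e = E.basis (xExp n a + e) := by
  rw [E.basis_apply, E.basis_apply, ← mul_assoc, ← orderedMonomial_add E.x_comm]
  congr 2
  · ext i; simp [xExp_inl]
  · ext j; simp [xExp_inr]

theorem orderedMonomial_single (i : Fin m) :
    orderedMonomial E.x (single i 1 : Fin m →₀ ℕ) = E.x i := by
  have := mul_orderedMonomial E.x i 0 fun _ _ => rfl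
  rw [orderedMonomial_zero, mul_one, zero_add] at this
  rw [this]
  congr 1
  ext j
  simp [single_apply, Pi.single_apply, eq_comm]

theorem x_mul_basis (i : Fin m) (e : (Fin m ⊕ Fin n) →₀ ℕ) :
    E.x i * E.basis e = E.basis (e + single (Sum.inl i) 1) := by
  rw [← orderedMonomial_single, xMonomial_mul_basis, xExp_single, add_comm]

theorem y_mul_basis {i : Fin n} {e : (Fin m ⊕ Fin n) →₀ ℕ} (hx : ∀ j, e (Sum.inl j) = 0)
    (hy : ∀ j < i, e (Sum.inr j) = 0) :
    E.y i * E.basis e = E.basis (e + single (Sum.inr i) 1) := by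
  have h0 : (fun j => e (Sum.inl j)) = 0 := funext hx
  rw [E.basis_apply, E.basis_apply, h0, orderedMonomial_zero, one_mul,
    mul_orderedMonomial _ _ _ hy]
  have h1 : (fun j => (e + single (Sum.inr i) 1 : (Fin m ⊕ Fin n) →₀ ℕ) (Sum.inl j)) = 0 := by
    ext j; simp [hx]
  rw [h1, orderedMonomial_zero, one_mul]
  congr 1
  ext j
  simp [single_apply, Pi.single_apply, eq_comm]

/-- `e'` has lower weight than `e` for all the weights of the polynomial region. -/
def Below (e' e : (Fin m ⊕ Fin n) →₀ ℕ) : Prop :=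
  ∀ w ∈ E.polynomialRegion, expWeight w e' < expWeight w e

/-- The span of the standard monomials below `c`. -/
noncomputable def low (c : (Fin m ⊕ Fin n) →₀ ℕ) : Submodule k R :=
  Submodule.span k (E.basis '' {e | E.Below e c})

variable {E}

theorem Below.trans {e₁ e₂ e₃ : (Fin m ⊕ Fin n) →₀ ℕ} (h : E.Below e₁ e₂) (h' : E.Below e₂ e₃) :
    E.Below e₁ e₃ := fun w hw => (h w hw).trans (h' w hw)

theorem Below.add_right {e₁ e₂ : (Fin m ⊕ Fin n) →₀ ℕ} (h : E.Below e₁ e₂)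
    (c : (Fin m ⊕ Fin n) →₀ ℕ) : E.Below (e₁ + c) (e₂ + c) := fun w hw => by
  rw [expWeight_add, expWeight_add]; linarith [h w hw]

theorem Below.add_left {e₁ e₂ : (Fin m ⊕ Fin n) →₀ ℕ} (h : E.Below e₁ e₂)
    (c : (Fin m ⊕ Fin n) →₀ ℕ) : E.Below (c + e₁) (c + e₂) := fun w hw => by
  rw [expWeight_add, expWeight_add]; linarith [h w hw]

theorem low_mono {c c' : (Fin m ⊕ Fin n) →₀ ℕ} (h : E.Below c c') : E.low c ≤ E.low c' :=
  Submodule.span_mono (Set.image_mono fun _ he => Below.trans he h)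

theorem basis_mem_low {e c : (Fin m ⊕ Fin n) →₀ ℕ} (h : E.Below e c) : E.basis e ∈ E.low c :=
  Submodule.subset_span ⟨e, h, rfl⟩

theorem xMonomial_mul_mem_low (a : Fin m →₀ ℕ) {c : (Fin m ⊕ Fin n) →₀ ℕ} {v : R}
    (hv : v ∈ E.low c) : orderedMonomial E.x a * v ∈ E.low (xExp n a + c) := by
  induction hv using Submodule.span_induction with
  | mem v hv =>
    obtain ⟨e, he, rfl⟩ := hv
    rw [xMonomial_mul_basis]
    exact basis_mem_low (Below.add_left he _)
  | zero => simp
  | add v v' _ _ h h' => rw [mul_add]; exact add_mem h h'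
  | smul c v _ h => rw [mul_smul_comm]; exact Submodule.smul_mem _ _ h

variable (E) in
/-- Multiplication of a standard monomial by a generator gives a standard monomial up to lower
terms. -/
def MulLower (s : Fin m ⊕ Fin n) (e : (Fin m ⊕ Fin n) →₀ ℕ) : Prop :=
  E.gen s * E.basis e - E.basis (e + single s 1) ∈ E.low (e + single s 1)

theorem gen_mul_mem_low {s : Fin m ⊕ Fin n} {c : (Fin m ⊕ Fin n) →₀ ℕ}
    (h : ∀ e, E.Below e c → E.MulLower s e) {v : R} (hv : v ∈ E.low c) :
    E.gen s * v ∈ E.low (c + single s 1) := by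
  induction hv using Submodule.span_induction with
  | mem v hv =>
    obtain ⟨e, he, rfl⟩ := hv
    rw [← sub_add_cancel (E.gen s * E.basis e) (E.basis (e + single s 1))]
    exact add_mem (low_mono (Below.add_right he _) (h e he))
      (basis_mem_low (Below.add_right he _))
  | zero => simp
  | add v v' _ _ h h' => rw [mul_add]; exact add_mem h h'
  | smul c v _ h => rw [mul_smul_comm]; exact Submodule.smul_mem _ _ h

theorem evalOrdered_mul_mem {q : MvPolynomial (Fin m) k} {N : Submodule k R} {v : R}
    (h : ∀ a ∈ q.support, orderedMonomial E.x a * v ∈ N) : evalOrdered E.x q * v ∈ N := by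
  rw [evalOrdered, Finset.sum_mul]
  refine N.sum_mem fun a ha => ?_
  rw [smul_mul_assoc]
  exact N.smul_mem _ (h a ha)

theorem below_Q1 {i : Fin n} {j : Fin m} {a : Fin m →₀ ℕ} (ha : a ∈ (E.Q1 i j).support) :
    E.Below (xExp n a) (single (Sum.inr i) 1 + single (Sum.inl j) 1) := fun w hw => by
  rw [expWeight_xExp, expWeight_add, expWeight_single, expWeight_single]
  exact hw.1 i j a ha

theorem below_Q20 {i j : Fin n} {a : Fin m →₀ ℕ} (ha : a ∈ (E.Q20 i j).support) :
    E.Below (xExp n a) (single (Sum.inr i) 1 + single (Sum.inr j) 1) := fun w hw => by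
  rw [expWeight_xExp, expWeight_add, expWeight_single, expWeight_single]
  exact hw.2.1 i j a ha

theorem below_Q2 {i j l : Fin n} {a : Fin m →₀ ℕ} (ha : a ∈ (E.Q2 i j l).support) :
    E.Below (xExp n a + single (Sum.inr l) 1) (single (Sum.inr i) 1 + single (Sum.inr j) 1) :=
  fun w hw => by
  rw [expWeight_add, expWeight_xExp, expWeight_add, expWeight_single, expWeight_single,
    expWeight_single]
  exact hw.2.2 i j l a ha

/-- Give the `x` generators weight 1 and the `y` generators a weight exceeding the degrees of all
the polynomials in the relations. -/
theorem exists_positive (E : AlmostCentralizingExtension k R m n) :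
    ∃ p ∈ E.polynomialRegion, ∀ s, 0 < p s := by
  have h : ∀ᶠ N : ℕ in Filter.atTop,
      (∀ i j, ∀ a ∈ (E.Q1 i j).support, a.degree < N) ∧
      (∀ i j, ∀ a ∈ (E.Q20 i j).support, a.degree < N) ∧
      (∀ i j l, ∀ a ∈ (E.Q2 i j l).support, a.degree < N) := by
    refine Filter.Eventually.and ?_ (Filter.Eventually.and ?_ ?_) <;>
    simp only [Filter.eventually_all, Finset.eventually_all] <;>
    intros <;> exact Filter.eventually_gt_atTop _
  obtain ⟨N, ⟨h1, h2, h3⟩, hN⟩ := (h.and (Filter.eventually_gt_atTop 0)).exists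
  have hN' : (0 : ℝ) < N := Nat.cast_pos.2 hN
  have hdeg : ∀ a : Fin m →₀ ℕ, expWeight (fun _ => (1 : ℝ)) a = (a.degree : ℝ) := fun a => by
    simp [expWeight, Finsupp.degree_eq_sum]
  refine ⟨Sum.elim (fun _ => 1) fun _ => N, ⟨fun i j a ha => ?_, fun i j a ha => ?_,
    fun i j l a ha => ?_⟩, ?_⟩
  · have : (a.degree : ℝ) < N := Nat.cast_lt.2 (h1 i j a ha)
    simp only [Sum.elim_inl, Sum.elim_inr, hdeg]
    linarith
  · have : (a.degree : ℝ) < N := Nat.cast_lt.2 (h2 i j a ha)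
    simp only [Sum.elim_inl, Sum.elim_inr, hdeg]
    linarith
  · have : (a.degree : ℝ) < N := Nat.cast_lt.2 (h3 i j l a ha)
    simp only [Sum.elim_inl, Sum.elim_inr, hdeg]
    linarith
  · rintro (s | s)
    · exact one_pos
    · exact hN'

theorem exists_eq_add_single {σ : Type*} {e : σ →₀ ℕ} {s : σ} (h : e s ≠ 0) :
    ∃ e', e = e' + single s 1 := by
  have : single s 1 ≤ e := by
    rw [single_le_iff]; exact Nat.one_le_iff_ne_zero.2 h
  exact ⟨e - single s 1, (tsub_add_cancel_of_le this).symm⟩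

theorem expWeight_nonneg {σ : Type*} [Fintype σ] {p : σ → ℝ} (hp : ∀ s, 0 < p s) (e : σ →₀ ℕ) :
    0 ≤ expWeight p e :=
  Finset.sum_nonneg fun s _ => mul_nonneg (hp s).le (Nat.cast_nonneg _)

/-- Move the generator to its place by the defining relations. Each commutator is lower for all
weights of the polynomial region by the very definition of that region; a positive weight of the
region makes the recursion terminate. -/
theorem mulLower (s : Fin m ⊕ Fin n) (e : (Fin m ⊕ Fin n) →₀ ℕ) : E.MulLower s e := by
  obtain ⟨p, hpR, hp⟩ := E.exists_positive
  generalize hT : e + single s 1 = T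
  induction T using (wellFounded_orderKey hp).induction generalizing s e with
  | _ T IH =>
  have ih : ∀ s' e', expWeight p e' + p s' < expWeight p e + p s → E.MulLower s' e' := by
    intro s' e' hlt
    refine IH (e' + single s' 1) (orderKey_lt_of_expWeight_lt ?_) s' e' rfl
    rwa [← hT, expWeight_add, expWeight_add, expWeight_single, expWeight_single]
  clear IH hT T
  rw [MulLower]
  rcases s with j | i
  · simp [gen, x_mul_basis]
  by_cases hx : ∃ j, e (Sum.inl j) ≠ 0
  · obtain ⟨j, hj⟩ := hx
    obtain ⟨e, rfl⟩ := exists_eq_add_single hj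
    rw [expWeight_add, expWeight_single] at ih
    have h1 : E.MulLower (Sum.inr i) e := ih _ _ (by linarith [hp (Sum.inl j)])
    have hrel : E.y i * E.x j = E.x j * E.y i + evalOrdered E.x (E.Q1 i j) :=
      eq_add_of_sub_eq' (E.rel1 i j)
    have hexp : e + single (Sum.inl j) 1 + single (Sum.inr i) 1 =
        e + single (Sum.inr i) 1 + single (Sum.inl j) 1 := add_right_comm _ _ _
    have key : E.gen (Sum.inr i) * E.basis (e + single (Sum.inl j) 1) -
        E.basis (e + single (Sum.inl j) 1 + single (Sum.inr i) 1) =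
        E.gen (Sum.inl j) * (E.gen (Sum.inr i) * E.basis e - E.basis (e + single (Sum.inr i) 1)) +
          evalOrdered E.x (E.Q1 i j) * E.basis e := by
      rw [hexp, ← x_mul_basis, ← x_mul_basis]
      simp only [gen, Sum.elim_inl, Sum.elim_inr]
      rw [← mul_assoc, hrel, mul_sub, add_mul, mul_assoc]
      abel
    rw [key, hexp]
    refine add_mem (gen_mul_mem_low (fun e' _ => ?_) h1) (evalOrdered_mul_mem fun a ha => ?_)
    · simp [MulLower, gen, x_mul_basis]
    · rw [xMonomial_mul_basis, add_comm (xExp n a), add_assoc]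
      exact basis_mem_low (Below.add_left (below_Q1 ha) _)
  push Not at hx
  by_cases hy : ∀ j < i, e (Sum.inr j) = 0
  · rw [show E.gen (Sum.inr i) = E.y i from rfl, y_mul_basis E hx hy, sub_self]
    exact zero_mem _
  push Not at hy
  classical
  -- The first factor y_j of the monomial is the one to pass; minimality of `j` makes prepending y_j
  -- to the remaining products exact.
  obtain ⟨j, ⟨hji, hj⟩, hmin⟩ := WellFounded.has_min
    (wellFounded_lt : WellFounded ((· < ·) : Fin n → Fin n → Prop))
    {j | j < i ∧ e (Sum.inr j) ≠ 0} hy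
  have hmin' : ∀ l < j, e (Sum.inr l) = 0 := fun l hl => by
    by_contra hne
    exact hmin l ⟨hl.trans hji, hne⟩ hl
  obtain ⟨e, rfl⟩ := exists_eq_add_single hj
  have hx' : ∀ l, e (Sum.inl l) = 0 := fun l => by simpa using hx l
  have hy' : ∀ l < j, e (Sum.inr l) = 0 := fun l hl => by
    have := hmin' l hl
    rw [Finsupp.add_apply] at this
    omega
  rw [expWeight_add, expWeight_single] at ih
  have h1 : E.MulLower (Sum.inr i) e := ih _ _ (by linarith [hp (Sum.inr j)])
  have hrel : E.y i * E.y j = E.y j * E.y i + (evalOrdered E.x (E.Q20 i j) +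
      ∑ l, evalOrdered E.x (E.Q2 i j l) * E.y l) := eq_add_of_sub_eq' (E.rel2 i j)
  have hexp : e + single (Sum.inr j) 1 + single (Sum.inr i) 1 =
      e + single (Sum.inr i) 1 + single (Sum.inr j) 1 := add_right_comm _ _ _
  have hij : E.y j * E.basis (e + single (Sum.inr i) 1) =
      E.basis (e + single (Sum.inr i) 1 + single (Sum.inr j) 1) := by
    refine y_mul_basis E (fun l => by simp [hx']) fun l hl => ?_
    rw [Finsupp.add_apply, hy' l hl, zero_add, single_eq_of_ne]
    simpa using (hl.trans hji).ne
  have key : E.gen (Sum.inr i) * E.basis (e + single (Sum.inr j) 1) -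
      E.basis (e + single (Sum.inr j) 1 + single (Sum.inr i) 1) =
      E.gen (Sum.inr j) * (E.gen (Sum.inr i) * E.basis e - E.basis (e + single (Sum.inr i) 1)) +
        (evalOrdered E.x (E.Q20 i j) * E.basis e +
          ∑ l, evalOrdered E.x (E.Q2 i j l) * (E.y l * E.basis e)) := by
    rw [hexp, ← hij, ← y_mul_basis E hx' hy']
    simp only [gen, Sum.elim_inr]
    rw [← mul_assoc, hrel, mul_sub, add_mul, add_mul, Finset.sum_mul]
    simp only [mul_assoc]
    abel
  rw [key, hexp]
  -- The errors are y_j times the lower terms of y_i times the monomial of `e`, and the two parts of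
  -- the commutator. In the last part, y_l times the monomial of `e` is covered by induction because
  -- the accompanying `x`-monomial has nonnegative weight.
  refine add_mem (gen_mul_mem_low (fun e' he' => ih _ _ ?_) h1)
    (add_mem (evalOrdered_mul_mem fun a ha => ?_)
      (sum_mem fun l _ => evalOrdered_mul_mem fun a ha => ?_))
  · have := he' p hpR
    rw [expWeight_add, expWeight_single] at this
    linarith
  · rw [xMonomial_mul_basis, add_comm (xExp n a), add_assoc]
    exact basis_mem_low (Below.add_left (below_Q20 ha) _)
  · have hb := below_Q2 ha
    have h2 : E.MulLower (Sum.inr l) e := by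
      refine ih _ _ ?_
      have := hb p hpR
      simp only [expWeight_add, expWeight_single] at this
      linarith [expWeight_nonneg hp (xExp n a)]
    have hb' : E.Below (xExp n a + (e + single (Sum.inr l) 1))
        (e + single (Sum.inr i) 1 + single (Sum.inr j) 1) := by
      rw [add_assoc, add_left_comm]
      exact hb.add_left e
    rw [← sub_add_cancel (E.y l * E.basis e) (E.basis (e + single (Sum.inr l) 1)), mul_add,
      xMonomial_mul_basis]
    exact add_mem (low_mono hb' (xMonomial_mul_mem_low a h2)) (basis_mem_low hb')

end AlmostCentralizingExtension

/-! ### Transfer from left ideals to filtered subspaces. -/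

namespace AlmostCentralizingExtension

open Finsupp GroebnerFan

variable {k R : Type*} [Field k] [Ring R] [Algebra k R] {m n : ℕ}
  (E : AlmostCentralizingExtension k R m n)

open Classical in
/-- The integral inequalities that define the polynomial region. -/
noncomputable def regionIneqs : Finset (Fin m ⊕ Fin n → ℤ) :=
  (Finset.univ.biUnion fun i => Finset.univ.biUnion fun j => (E.Q1 i j).support.image fun a =>
    expDiff (single (Sum.inr i) 1 + single (Sum.inl j) 1) (xExp n a)) ∪
  (Finset.univ.biUnion fun i => Finset.univ.biUnion fun j => (E.Q20 i j).support.image fun a =>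
    expDiff (single (Sum.inr i) 1 + single (Sum.inr j) 1) (xExp n a)) ∪
  (Finset.univ.biUnion fun i => Finset.univ.biUnion fun j => Finset.univ.biUnion fun l =>
    (E.Q2 i j l).support.image fun a =>
      expDiff (single (Sum.inr i) 1 + single (Sum.inr j) 1) (xExp n a + single (Sum.inr l) 1))

theorem forall_mem_regionIneqs {w : Fin m ⊕ Fin n → ℝ} :
    (∀ a ∈ E.regionIneqs, 0 < pairing a w) ↔ w ∈ E.polynomialRegion := by
  simp only [regionIneqs, Finset.mem_union, Finset.mem_biUnion, Finset.mem_univ, true_and,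
    Finset.mem_image, polynomialRegion, Set.mem_ofPred_eq, or_imp, forall_and, forall_exists_index, and_imp]
  constructor
  · rintro ⟨⟨h1, h2⟩, h3⟩
    refine ⟨fun i j a ha => ?_, fun i j a ha => ?_, fun i j l a ha => ?_⟩
    · have := h1 _ i j a ha rfl
      rwa [pairing_expDiff, sub_pos, expWeight_xExp, expWeight_add, expWeight_single,
        expWeight_single] at this
    · have := h2 _ i j a ha rfl
      rwa [pairing_expDiff, sub_pos, expWeight_xExp, expWeight_add, expWeight_single,
        expWeight_single] at this
    · have := h3 _ i j l a ha rfl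
      rwa [pairing_expDiff, sub_pos, expWeight_add, expWeight_xExp, expWeight_add,
        expWeight_single, expWeight_single, expWeight_single] at this
  · rintro ⟨h1, h2, h3⟩
    refine ⟨⟨?_, ?_⟩, ?_⟩
    · rintro _ i j a ha rfl
      rw [pairing_expDiff, sub_pos, expWeight_xExp, expWeight_add, expWeight_single,
        expWeight_single]
      exact h1 i j a ha
    · rintro _ i j a ha rfl
      rw [pairing_expDiff, sub_pos, expWeight_xExp, expWeight_add, expWeight_single,
        expWeight_single]
      exact h2 i j a ha
    · rintro _ i j l a ha rfl
      rw [pairing_expDiff, sub_pos, expWeight_add, expWeight_xExp, expWeight_add,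
        expWeight_single, expWeight_single, expWeight_single]
      exact h3 i j l a ha

/-- A left ideal, as a subspace of the space of polynomials. -/
noncomputable def filteredSubspace (I : Ideal R) : FilteredSubspace k (Fin m ⊕ Fin n) where
  op s := E.basis.repr.toLinearMap ∘ₗ LinearMap.mulLeft k (E.gen s) ∘ₗ
    E.basis.repr.symm.toLinearMap
  space := (I.restrictScalars k).map E.basis.repr.toLinearMap
  ineqs := E.regionIneqs
  op_mem := by
    rintro s _ ⟨f, hf, rfl⟩
    refine ⟨E.gen s * f, I.mul_mem_left _ hf, ?_⟩
    simp
  exists_pos := by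
    obtain ⟨p, hp, hpos⟩ := E.exists_positive
    exact ⟨p, E.forall_mem_regionIneqs.2 hp, hpos⟩
  lower := by
    intro s e e' he' w hw
    have h := E.mulLower s e
    -- Membership in a span of basis vectors is a condition on the support of the coordinates.
    rw [MulLower, low, Module.Basis.mem_span_image] at h
    refine h (?_ : e' ∈ _) w (E.forall_mem_regionIneqs.1 hw)
    simpa using he'

theorem mem_region_filteredSubspace {I : Ideal R} {w : Fin m ⊕ Fin n → ℝ} :
    w ∈ (E.filteredSubspace I).region ↔ w ∈ E.polynomialRegion := E.forall_mem_regionIneqs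

theorem initialForm_eq (w : Fin m ⊕ Fin n → ℝ) (f : R) :
    E.initialForm w f =
      (MvPolynomial.basisMonomials (Fin m ⊕ Fin n) k).repr.symm (initial w (E.basis.repr f)) := by
  classical
  rw [initialForm, initial, Module.Basis.repr_symm_apply, linearCombination_apply, Finsupp.sum,
    support_filter]
  refine Finset.sum_congr (by congr) fun e he => ?_
  rw [filter_apply, if_pos (Finset.mem_filter.1 he).2, MvPolynomial.coe_basisMonomials,
    MvPolynomial.smul_monomial, smul_eq_mul, mul_one]

theorem initialIdeal_eq (I : Ideal R) (w : Fin m ⊕ Fin n → ℝ) :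
    E.initialIdeal I w = ((E.filteredSubspace I).initialSpan w).map
      (MvPolynomial.basisMonomials (Fin m ⊕ Fin n) k).repr.symm.toLinearMap := by
  rw [initialIdeal, FilteredSubspace.initialSpan, Submodule.map_span]
  congr 1
  ext g
  constructor
  · rintro ⟨f, hf, rfl⟩
    exact ⟨_, ⟨_, ⟨f, hf, rfl⟩, rfl⟩, (E.initialForm_eq w f).symm⟩
  · rintro ⟨_, ⟨_, ⟨f, hf, rfl⟩, rfl⟩, rfl⟩
    exact ⟨f, hf, (E.initialForm_eq w f).symm⟩

theorem initialIdeal_eq_iff {I : Ideal R} {w w' : Fin m ⊕ Fin n → ℝ} :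
    E.initialIdeal I w = E.initialIdeal I w' ↔
      (E.filteredSubspace I).initialSpan w = (E.filteredSubspace I).initialSpan w' := by
  rw [initialIdeal_eq, initialIdeal_eq]
  exact (Submodule.map_injective_of_injective
    (MvPolynomial.basisMonomials (Fin m ⊕ Fin n) k).repr.symm.injective).eq_iff

theorem groebnerRegion_eq (I : Ideal R) :
    E.groebnerRegion I = (E.filteredSubspace I).groebnerRegion := by
  ext w
  simp only [groebnerRegion, FilteredSubspace.groebnerRegion, FilteredSubspace.positiveRegion,
    Set.mem_ofPred_eq, mem_region_filteredSubspace, initialIdeal_eq_iff, and_assoc]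

theorem closure_equivClass {I : Ideal R} {w w' : Fin m ⊕ Fin n → ℝ}
    (hw' : w' ∈ (E.filteredSubspace I).positiveRegion)
    (h : (E.filteredSubspace I).initialSpan w = (E.filteredSubspace I).initialSpan w') :
    closure (E.equivClass I w) = ((E.filteredSubspace I).cone w' : Set (Fin m ⊕ Fin n → ℝ)) := by
  rw [← FilteredSubspace.closure_openCone hw'.1, FilteredSubspace.openCone_eq hw']
  congr 1
  ext z
  simp only [equivClass, Set.mem_ofPred_eq, mem_region_filteredSubspace, initialIdeal_eq_iff, h]

theorem groebnerCones_eq (I : Ideal R) :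
    E.groebnerCones I = (E.filteredSubspace I).cones := by
  ext C
  constructor
  · rintro ⟨w, hw, hC⟩
    rw [groebnerRegion_eq] at hw
    obtain ⟨-, w', hw', h⟩ := hw
    refine ⟨w', hw', SetLike.coe_injective ?_⟩
    rw [hC, E.closure_equivClass hw' h]
  · rintro ⟨w, hw, rfl⟩
    refine ⟨w, ?_, (E.closure_equivClass hw rfl).symm⟩
    rw [groebnerRegion_eq]
    exact ⟨hw.1, w, hw, rfl⟩

end AlmostCentralizingExtension

theorem mainTheorem6 {k R : Type*} [Field k] [Ring R] [Algebra k R] {m n : ℕ}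
    (E : AlmostCentralizingExtension k R m n) (I : Ideal R) :
    -- the closure of every class of a vector in the Gröbner region is a cone
    (∀ w ∈ E.groebnerRegion I, ∃ C ∈ E.groebnerCones I,
      (C : Set (Fin m ⊕ Fin n → ℝ)) = closure (E.equivClass I w)) ∧
    -- there are finitely many of these cones
    (E.groebnerCones I).Finite ∧
    -- with their faces they form a fan; any two of them meet in a common face
    IsRationalFan {F | ∃ C ∈ E.groebnerCones I, F.IsFaceOf C} ∧
    -- a face of one of them is again one of them exactly when it meets the Gröbner region
    (∀ C ∈ E.groebnerCones I, ∀ F : PointedCone ℝ (Fin m ⊕ Fin n → ℝ), F.IsFaceOf C →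
      (F ∈ E.groebnerCones I ↔
        ((F : Set (Fin m ⊕ Fin n → ℝ)) ∩ E.groebnerRegion I).Nonempty)) := by

  rw [E.groebnerCones_eq, E.groebnerRegion_eq]
  refine ⟨?_, GroebnerFan.FilteredSubspace.finite_cones _,
    GroebnerFan.FilteredSubspace.isRationalFan_faces _,
    fun C hC F hF => GroebnerFan.FilteredSubspace.isFaceOf_mem_cones_iff hC hF⟩
  rintro w ⟨-, w', hw', h⟩
  exact ⟨_, ⟨w', hw', rfl⟩, (E.closure_equivClass hw' h).symm⟩
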